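/- \textbf{Setting.} An approval profile over a finite set $C$ of candidates is a finite sequence of ballots $A_1,\dots,A_n\subseteq C$. Satisfaction Approval Voting (SAV) with committee size $k$ elects the set $W\subseteq C$ with $|W|=k$ that maximizes \[ \mathrm{Sat}(W)=\sum_{i=1}^{n}\frac{|W\cap A_i|}{|A_i|} \] (an empty ballot contributes $0$). Ties are broken by a given linear priority order $\succ$ on $C$, extended lexicographically: among the maximizing sets of size $k$, $W$ is preferred to $W'$ if the $\succ$-highest candidate in the symmetric difference of $W$ and $W'$ belongs to $W$. \textbf{Problem} (Winning Set Manipulation for SAV with two agents still to vote). Input: a finite set $C$ of candidates, ballots $A_1,\dots,A_n\subseteq C$, a committee size $k\in\mathbb{N}$, a set $P\subseteq C$ and a linear order $\succ$ on $C$. Question: are there two additional ballots $B_1,B_2\subseteq C$ such that $P$ is the winning set of size $k$ under SAV for the profile $A_1,\dots,A_n,B_1,B_2$ with tie-breaking order $\succ$? \textbf{Theorem.} This problem is solvable in polynomial time: there are an algorithm and a polynomial $T$ such that on every input the algorithm answers the question correctly within $T(s)$ steps, where $s$ is the bit size of the input (numbers are written in binary, sets of candidates as $0/1$-vectors indexed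 by $C$, the order as the list of the positions of the candidates). Here $k$ is part of the input and is not bounded by a constant. Steps are counted on a random access machine under the logarithmic cost criterion, which is polynomially equivalent to counting steps of a Turing machine. -/

import Mathlib

/-! ## Random access machines with logarithmic cost

A memory is a function `M : ℕ → ℕ` (register `i` holds the natural number `M i`). Programs are
structured random access machine programs (no recursion, no unbounded data in the program text).
Running time is measured by the logarithmic cost criterion: each number that is read, computed,
stored or used as an address is charged its number of binary digits, plus one per operation. Up to
polynomials this is the running time of Turing machines. -/

/-- Expressions: constants, indirect addressing, and the operations `+`, `-` (truncated at `0`)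
and `*` on natural numbers. -/
inductive RamExpr : Type
  | lit (n : ℕ)
  | load (a : RamExpr)
  | add (a b : RamExpr)
  | sub (a b : RamExpr)
  | mul (a b : RamExpr)

namespace RamExpr

/-- The value of an expression in the memory `M`; `load a` is the content of the register whose
address is the value of `a`. -/
def eval (M : ℕ → ℕ) : RamExpr → ℕ
  | lit n => n
  | load a => M (a.eval M)
  | add a b => a.eval M + b.eval M
  | sub a b => a.eval M - b.eval M
  | mul a b => a.eval M * b.eval M

/-- The logarithmic cost of evaluating an expression: every node of the expression tree is charged
one plus the number of binary digits of its value. -/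
def cost (M : ℕ → ℕ) : RamExpr → ℕ
  | lit n => Nat.size n + 1
  | load a => a.cost M + Nat.size (M (a.eval M)) + 1
  | add a b => a.cost M + b.cost M + Nat.size (a.eval M + b.eval M) + 1
  | sub a b => a.cost M + b.cost M + Nat.size (a.eval M - b.eval M) + 1
  | mul a b => a.cost M + b.cost M + Nat.size (a.eval M * b.eval M) + 1

end RamExpr

/-- Programs: do nothing; store the value of `e` in the register with address (the value of) `a`;
sequential composition; branch on `e ≠ 0`; repeat while `e ≠ 0`. -/
inductive RamProg : Type
  | skip
  | store (a e : RamExpr)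
  | seq (p q : RamProg)
  | ite (e : RamExpr) (p q : RamProg)
  | loop (e : RamExpr) (p : RamProg)

/-- `RamExec p M M' t`: started in the memory `M`, the program `p` halts with memory `M'`
at total logarithmic cost `t`. -/
inductive RamExec : RamProg → (ℕ → ℕ) → (ℕ → ℕ) → ℕ → Prop
  | skip (M : ℕ → ℕ) : RamExec RamProg.skip M M 1
  | store (a e : RamExpr) (M : ℕ → ℕ) :
      RamExec (RamProg.store a e) M (Function.update M (a.eval M) (e.eval M))
        (a.cost M + e.cost M + 1)
  | seq {p q : RamProg} {M M' M'' : ℕ → ℕ} {t t' : ℕ} :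
      RamExec p M M' t → RamExec q M' M'' t' → RamExec (RamProg.seq p q) M M'' (t + t' + 1)
  | ite_true {e : RamExpr} {p q : RamProg} {M M' : ℕ → ℕ} {t : ℕ} :
      e.eval M ≠ 0 → RamExec p M M' t → RamExec (RamProg.ite e p q) M M' (e.cost M + t + 1)
  | ite_false {e : RamExpr} {p q : RamProg} {M M' : ℕ → ℕ} {t : ℕ} :
      e.eval M = 0 → RamExec q M M' t → RamExec (RamProg.ite e p q) M M' (e.cost M + t + 1)
  | loop_done {e : RamExpr} {p : RamProg} {M : ℕ → ℕ} :
      e.eval M = 0 → RamExec (RamProg.loop e p) M M (e.cost M + 1)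
  | loop_step {e : RamExpr} {p : RamProg} {M M' M'' : ℕ → ℕ} {t t' : ℕ} :
      e.eval M ≠ 0 → RamExec p M M' t → RamExec (RamProg.loop e p) M' M'' t' →
      RamExec (RamProg.loop e p) M M'' (e.cost M + t + t' + 1)

/-- The initial memory on the input `l`: register `0` holds the length of `l`, the registers
`1, 2, …` hold the entries of `l`, and all other registers hold `0`. -/
def ramInput (l : List ℕ) : ℕ → ℕ :=
  fun i => (l.length :: l).getD i 0

/-- The size in bits of an input that is a list of natural numbers written in binary (with one
delimiter for each entry). -/
def ramInputSize (l : List ℕ) : ℕ :=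
  (l.map fun a => Nat.size a + 1).sum

/-- The decision problem `Q` on instances in `α`, which are encoded by `enc`, is solvable in
polynomial time: a single program halts on all instances within a time that is polynomial in the
bit size of the encoded instance, and answers (in register `0`) `1` if `Q` holds and `0` if not. -/
def PolyTimeDecidable {α : Type} (enc : α → List ℕ) (Q : α → Prop) : Prop :=
  ∃ (p : RamProg) (T : Polynomial ℕ), ∀ x : α, ∃ (M : ℕ → ℕ) (t : ℕ),
    RamExec p (ramInput (enc x)) M t ∧ t ≤ T.eval (ramInputSize (enc x)) ∧
      (Q x → M 0 = 1) ∧ (¬ Q x → M 0 = 0)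

/-! ## Approval-based multi-winner rules -/

/-- An approval-based multi-winner rule: for `m` candidates, approval ballots `A 0, …, A (n - 1)`,
a committee size `k` and a tie-breaking order `tie` (candidate `c` has priority over candidate `d`
if `tie c < tie d`), the statement that the set `W` is the winning set. -/
def ApprovalRule : Type :=
  ∀ m n : ℕ, (Fin n → Finset (Fin m)) → ℕ → Equiv.Perm (Fin m) → Finset (Fin m) → Prop

/-- The total satisfaction `∑ i, |W ∩ A i| / |A i|`; an empty ballot contributes `0`. -/
def satisfaction {m n : ℕ} (A : Fin n → Finset (Fin m)) (W : Finset (Fin m)) : ℚ :=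
  ∑ i, ((W ∩ A i).card : ℚ) / ((A i).card : ℚ)

/-- The lexicographic extension of the priority order to sets of equal size: `W` is preferred to
`W'` if the candidate of highest priority on which they differ belongs to `W`. -/
def LexPreferred {m : ℕ} (tie : Equiv.Perm (Fin m)) (W W' : Finset (Fin m)) : Prop :=
  ∃ c ∈ W \ W', ∀ d ∈ W' \ W, tie c < tie d

/-- Satisfaction Approval Voting: the winning set is the set of size `k` of maximum total
satisfaction, ties between such sets being broken lexicographically. -/
def SAV : ApprovalRule := fun _ _ A k tie W =>
  W.card = k ∧ ∀ W' : Finset _, W'.card = k → W' ≠ W →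
    satisfaction A W' < satisfaction A W ∨
      (satisfaction A W' = satisfaction A W ∧ LexPreferred tie W W')

/-- The input of Winning Set Manipulation, apart from the rule and the number of agents still to
vote: `m` candidates, `n` approval ballots already cast, the committee size `k`, the set `P` of
preferred candidates, and the tie-breaking order. -/
structure WSMInstance : Type where
  m : ℕ
  n : ℕ
  ballots : Fin n → Finset (Fin m)
  k : ℕ
  P : Finset (Fin m)
  tie : Equiv.Perm (Fin m)

/-- The indicator vector of a set of candidates. -/
def indicatorList {m : ℕ} (S : Finset (Fin m)) : List ℕ :=
  List.ofFn fun c : Fin m => if c ∈ S then 1 else 0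

/-- An instance as a list of numbers: `m`, `n`, `k`, the indicator vector of `P`, the position of
each candidate in the tie-breaking order, and the indicator vectors of the ballots. -/
def WSMInstance.encode (I : WSMInstance) : List ℕ :=
  [I.m, I.n, I.k] ++ indicatorList I.P ++ (List.ofFn fun c : Fin I.m => (I.tie c : ℕ)) ++
    (List.ofFn fun i : Fin I.n => indicatorList (I.ballots i)).flatten

/-- Winning Set Manipulation for the rule `R` with `j` agents still to vote: are there `j`
additional approval ballots such that `P` is the winning set under `R`? -/
def WinningSetManipulation (R : ApprovalRule) (j : ℕ) (I : WSMInstance) : Prop :=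
  ∃ B : Fin j → Finset (Fin I.m), R I.m (I.n + j) (Fin.append I.ballots B) I.k I.tie I.P

/-!
Scaled by `m!`, the satisfaction with a committee is a sum of natural scores of its candidates, so
`P` wins if and only if some threshold on the scores, refined by the priority order, separates `P`
from the other candidates. The additional ballots enter the scores only through their sizes and
through the set of these ballots that contain the candidate. For each of the polynomially many
choices of the ballot sizes and of the threshold, a candidate thus independently allows certain sets
of ballots, and it remains to decide whether choices can be made whose ballot sizes are the
prescribed ones. The number of ways to do so is a coefficient of a polynomial that is a product over
the candidates; it is read off as a digit of the value of this polynomial at a large power of two.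

The running time is bounded by closure properties: the values that can be computed in polynomial
time from the input and some local variables are closed under arithmetic and under sums and products
over polynomially many indices.
-/

/-! ### Binary sizes -/

theorem natSize_le_self (a : ℕ) : a.size ≤ a := Nat.size_le.2 a.lt_two_pow_self

theorem natSize_add_le (a b : ℕ) : (a + b).size ≤ a.size + b.size + 1 := by
  have ha : 2 ^ a.size ≤ 2 ^ (a.size + b.size) := Nat.pow_le_pow_right two_pos (by omega)
  have hb : 2 ^ b.size ≤ 2 ^ (a.size + b.size) := Nat.pow_le_pow_right two_pos (by omega)
  have := a.lt_size_self
  have := b.lt_size_self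
  exact Nat.size_le.2 (by rw [pow_succ]; omega)

theorem natSize_mul_le (a b : ℕ) : (a * b).size ≤ a.size + b.size :=
  Nat.size_le.2 <| by
    rw [pow_add]
    exact Nat.mul_lt_mul'' a.lt_size_self b.lt_size_self

theorem length_le_ramInputSize (l : List ℕ) : l.length ≤ ramInputSize l := by
  simp [ramInputSize]

theorem size_ramInput_le (l : List ℕ) (i : ℕ) : (ramInput l i).size ≤ ramInputSize l := by
  rcases i with _ | i
  · exact (natSize_le_self _).trans (length_le_ramInputSize l)
  rcases lt_or_ge i l.length with hi | hi
  · have hmem : l[i].size + 1 ∈ l.map fun a => a.size + 1 := List.mem_map_of_mem (by simp)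
    have := List.single_le_sum (by simp) _ hmem
    simp only [ramInput, List.getD_cons_succ, List.getD_eq_getElem _ _ hi, ramInputSize]
    omega
  · simp [ramInput, hi]

theorem RamExpr.size_eval_le_cost (M : ℕ → ℕ) (e : RamExpr) : (e.eval M).size ≤ e.cost M := by
  cases e <;> simp only [eval, cost] <;> omega

/-! ### Polynomial bounds -/

/-- The function `g` is bounded by a polynomial in the size measure `s`. -/
def PolyBounded {X : Type*} (s g : X → ℕ) : Prop :=
  ∃ T : Polynomial ℕ, ∀ x, g x ≤ T.eval (s x)

theorem monotone_polynomial_eval (T : Polynomial ℕ) : Monotone fun n => T.eval n :=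
  fun a b hab => by
    simp only [Polynomial.eval_eq_sum]
    exact Finset.sum_le_sum fun i _ => Nat.mul_le_mul_left _ (Nat.pow_le_pow_left hab i)

namespace PolyBounded

variable {X Y : Type*} {s f g : X → ℕ}

theorem const (n : ℕ) : PolyBounded s fun _ => n := ⟨Polynomial.C n, fun x => by simp⟩

theorem refl : PolyBounded s s := ⟨Polynomial.X, fun x => by simp⟩

theorem mono (hg : PolyBounded s g) (hfg : ∀ x, f x ≤ g x) : PolyBounded s f :=
  hg.imp fun _ hT x => (hfg x).trans (hT x)

theorem of_le (h : ∀ x, f x ≤ s x) : PolyBounded s f := refl.mono h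

theorem size (hf : PolyBounded s f) : PolyBounded s fun x => (f x).size :=
  hf.mono fun x => natSize_le_self (f x)

theorem add : PolyBounded s f → PolyBounded s g → PolyBounded s fun x => f x + g x
  | ⟨T, hT⟩, ⟨U, hU⟩ => ⟨T + U, fun x => by
      simpa only [Polynomial.eval_add] using Nat.add_le_add (hT x) (hU x)⟩

theorem mul : PolyBounded s f → PolyBounded s g → PolyBounded s fun x => f x * g x
  | ⟨T, hT⟩, ⟨U, hU⟩ => ⟨T * U, fun x => by
      simpa only [Polynomial.eval_mul] using Nat.mul_le_mul (hT x) (hU x)⟩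

theorem trans : PolyBounded s f → PolyBounded f g → PolyBounded s g
  | ⟨T, hT⟩, ⟨U, hU⟩ => ⟨U.comp T, fun x => by
      simpa only [Polynomial.eval_comp] using (hU x).trans (monotone_polynomial_eval U (hT x))⟩

theorem comp (hg : PolyBounded s g) (φ : Y → X) :
    PolyBounded (fun y => s (φ y)) fun y => g (φ y) :=
  hg.imp fun _ hT y => hT (φ y)

end PolyBounded

/-! ### Program logic with polynomial time bounds -/

/-- Whenever a memory satisfies the precondition `H x`, the expression `e` has the value `v x`,
at a cost polynomial in `s x`. -/
def PolyEval {X : Type*} (s : X → ℕ) (H : X → (ℕ → ℕ) → Prop) (e : RamExpr) (v : X → ℕ) : Prop :=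
  ∃ c, PolyBounded s c ∧ ∀ x M, H x M → e.eval M = v x ∧ e.cost M ≤ c x

namespace PolyEval

variable {X Y : Type*} {s : X → ℕ} {H : X → (ℕ → ℕ) → Prop} {a b e : RamExpr} {u v w : X → ℕ}

theorem of_forall_not (h : ∀ x M, ¬ H x M) : PolyEval s H e v :=
  ⟨fun _ => 0, .const 0, fun x M hM => (h x M hM).elim⟩

theorem lit (n : ℕ) : PolyEval s H (.lit n) fun _ => n :=
  ⟨fun _ => n.size + 1, .const _, fun _ _ _ => ⟨rfl, le_rfl⟩⟩

theorem load : PolyEval s H a u → PolyBounded s (fun x => (w x).size) →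
    (∀ x M, H x M → M (u x) = w x) → PolyEval s H (.load a) w
  | ⟨c, hc, h⟩, hw, hM =>
    ⟨fun x => c x + (w x).size + 1, (hc.add hw).add (.const 1), fun x M hx => by
      obtain ⟨hu, hcost⟩ := h x M hx
      simp only [RamExpr.eval, RamExpr.cost, hu, hM x M hx, true_and]
      omega⟩

theorem add : PolyEval s H a u → PolyEval s H b v → PolyEval s H (.add a b) fun x => u x + v x
  | ⟨c, hc, ha⟩, ⟨d, hd, hb⟩ =>
    ⟨fun x => 2 * (c x + d x) + 2, ((PolyBounded.const 2).mul (hc.add hd)).add (.const 2),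
      fun x M hx => by
        have hsize := natSize_add_le (a.eval M) (b.eval M)
        have hca := a.size_eval_le_cost M
        have hcb := b.size_eval_le_cost M
        have := ha x M hx
        have := hb x M hx
        simp only [RamExpr.eval, RamExpr.cost]
        omega⟩

theorem sub : PolyEval s H a u → PolyEval s H b v → PolyEval s H (.sub a b) fun x => u x - v x
  | ⟨c, hc, ha⟩, ⟨d, hd, hb⟩ =>
    ⟨fun x => 2 * c x + d x + 1, (((PolyBounded.const 2).mul hc).add hd).add (.const 1),
      fun x M hx => by
        have hsize := Nat.size_le_size (Nat.sub_le (a.eval M) (b.eval M))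
        have hca := a.size_eval_le_cost M
        have := ha x M hx
        have := hb x M hx
        simp only [RamExpr.eval, RamExpr.cost]
        omega⟩

theorem mul : PolyEval s H a u → PolyEval s H b v → PolyEval s H (.mul a b) fun x => u x * v x
  | ⟨c, hc, ha⟩, ⟨d, hd, hb⟩ =>
    ⟨fun x => 2 * (c x + d x) + 1, ((PolyBounded.const 2).mul (hc.add hd)).add (.const 1),
      fun x M hx => by
        have hsize := natSize_mul_le (a.eval M) (b.eval M)
        have hca := a.size_eval_le_cost M
        have hcb := b.size_eval_le_cost M
        obtain ⟨hu, hcost⟩ := ha x M hx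
        obtain ⟨hv, hcost'⟩ := hb x M hx
        simp only [RamExpr.eval, RamExpr.cost, ← hu, ← hv, true_and]
        omega⟩

theorem conseq {s' : Y → ℕ} {K : Y → (ℕ → ℕ) → Prop} {t : Y → ℕ} (h : PolyEval s H e v)
    (φ : Y → X) (hs : PolyBounded s' fun y => s (φ y)) (hH : ∀ y M, K y M → H (φ y) M)
    (hv : ∀ y, v (φ y) = t y) : PolyEval s' K e t :=
  let ⟨c, hc, hM⟩ := h
  ⟨fun y => c (φ y), hs.trans (hc.comp φ), fun y M hy => hv y ▸ hM (φ y) M (hH y M hy)⟩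

end PolyEval

/-- Started in a memory with the precondition `H x`, the program `p` halts within a time
polynomial in `s x`, in a memory with the postcondition `H' x`. -/
def PolyTriple {X : Type*} (s : X → ℕ) (H : X → (ℕ → ℕ) → Prop) (p : RamProg)
    (H' : X → (ℕ → ℕ) → Prop) : Prop :=
  ∃ c, PolyBounded s c ∧ ∀ x M, H x M → ∃ M' t, RamExec p M M' t ∧ t ≤ c x ∧ H' x M'

namespace PolyTriple

variable {X Y : Type*} {s : X → ℕ} {H H' H'' : X → (ℕ → ℕ) → Prop} {p q : RamProg}

theorem store {a e : RamExpr} {u v : X → ℕ} :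
    PolyEval s H a u → PolyEval s H e v →
    (∀ x M, H x M → H' x (Function.update M (u x) (v x))) → PolyTriple s H (.store a e) H'
  | ⟨c, hc, ha⟩, ⟨d, hd, he⟩, h =>
    ⟨fun x => c x + d x + 1, (hc.add hd).add (.const 1), fun x M hx => by
      obtain ⟨hu, hcost⟩ := ha x M hx
      obtain ⟨hv, hcost'⟩ := he x M hx
      exact ⟨_, _, .store a e M, by dsimp only; omega, hu ▸ hv ▸ h x M hx⟩⟩

theorem seq : PolyTriple s H p H' → PolyTriple s H' q H'' → PolyTriple s H (.seq p q) H''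
  | ⟨c, hc, hp⟩, ⟨d, hd, hq⟩ =>
    ⟨fun x => c x + d x + 1, (hc.add hd).add (.const 1), fun x M hx => by
      obtain ⟨M', t, hexec, ht, hx'⟩ := hp x M hx
      obtain ⟨M'', t', hexec', ht', hx''⟩ := hq x M' hx'
      exact ⟨M'', _, .seq hexec hexec', by dsimp only; omega, hx''⟩⟩

theorem conseq {s' : Y → ℕ} {K K' : Y → (ℕ → ℕ) → Prop} {g : Y → ℕ} (h : PolyTriple s H p H')
    (φ : Y → (ℕ → ℕ) → X) (hg : PolyBounded s' g) (hs : ∀ y M, K y M → s (φ y M) ≤ g y)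
    (hH : ∀ y M, K y M → H (φ y M) M)
    (hH' : ∀ y M M', K y M → H' (φ y M) M' → K' y M') : PolyTriple s' K p K' := by
  obtain ⟨c, ⟨T, hT⟩, hp⟩ := h
  refine ⟨fun y => T.eval (g y), hg.trans ⟨T, fun _ => le_rfl⟩, fun y M hy => ?_⟩
  obtain ⟨M', t, hexec, ht, hM'⟩ := hp (φ y M) M (hH y M hy)
  exact ⟨M', t, hexec, ht.trans ((hT _).trans (monotone_polynomial_eval T (hs y M hy))),
    hH' y M M' hy hM'⟩

/-- The invariant `I x i` holds after `i` of the `N x` iterations. -/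
theorem loop {e : RamExpr} {N : X → ℕ} {I : X → ℕ → (ℕ → ℕ) → Prop} (hN : PolyBounded s N)
    (hguard : PolyEval (fun y : Σ x, Fin (N x + 1) => s y.1) (fun y => I y.1 y.2) e
      fun y => N y.1 - y.2)
    (hbody : PolyTriple (fun y : Σ x, Fin (N x) => s y.1) (fun y => I y.1 y.2) p
      fun y => I y.1 (y.2 + 1)) :
    PolyTriple s (fun x => I x 0) (.loop e p) fun x => I x (N x) := by
  obtain ⟨c, ⟨T, hT⟩, hguard⟩ := hguard
  obtain ⟨d, ⟨U, hU⟩, hbody⟩ := hbody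
  have hB : PolyBounded s fun x => T.eval (s x) + U.eval (s x) + 1 :=
    ⟨T + U + 1, fun x => by simp⟩
  refine ⟨_, (hN.add (.const 1)).mul hB, fun x M hx => ?_⟩
  suffices ∀ k i M, i + k = N x → I x i M → ∃ M' t, RamExec (.loop e p) M M' t ∧
      t ≤ (k + 1) * (T.eval (s x) + U.eval (s x) + 1) ∧ I x (N x) M' from
    this (N x) 0 M (by omega) hx
  intro k
  induction k with
  | zero =>
    intro i M hik hi
    obtain rfl : i = N x := by omega
    obtain ⟨heval, hcost⟩ := hguard ⟨x, N x, by omega⟩ M hi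
    have hc := hT ⟨x, N x, by omega⟩
    exact ⟨M, _, .loop_done (by simpa using heval), by simp only at hc hcost; omega, hi⟩
  | succ k ih =>
    intro i M hik hi
    obtain ⟨heval, hcost⟩ := hguard ⟨x, i, by omega⟩ M hi
    have hc := hT ⟨x, i, by omega⟩
    obtain ⟨M', t, hexec, ht, hi'⟩ := hbody ⟨x, i, by omega⟩ M hi
    have hd := hU ⟨x, i, by omega⟩
    obtain ⟨M'', t', hexec', ht', hN'⟩ := ih (i + 1) M' (by omega) hi'
    refine ⟨M'', _, .loop_step (by simp only at heval; omega) hexec hexec', ?_, hN'⟩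
    rw [add_mul, one_mul]
    simp only at hc hcost hd ht
    omega

end PolyTriple

/-! ### Environments -/

/-- The data available to a subroutine in the situation `a : α`: the unchanged input list of the
machine and the values of finitely many local variables, the most recently bound one first. -/
structure RamEnv (α : Type*) where
  input : α → List ℕ
  vars : α → List ℕ

namespace RamEnv

variable {α β : Type*}

/-- The size measure against which the running times of subroutines are polynomial. -/
def size (E : RamEnv α) (a : α) : ℕ := ramInputSize (E.input a) + ramInputSize (E.vars a)

/-- The environment in which one more variable, with value `v`, is bound; its situations `b` refine
the situations `π b` of `E`. -/
def extend (E : RamEnv α) (π : β → α) (v : β → ℕ) : RamEnv β where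
  input b := E.input (π b)
  vars b := v b :: E.vars (π b)

/-- The environment in which a variable with the value `g` is bound. -/
abbrev push (E : RamEnv α) (g : α → ℕ) : RamEnv α := E.extend id g

/-- The environment inside an iteration `i = 0, …, N - 1`, in which `i` is bound. -/
abbrev bind (E : RamEnv α) (N : α → ℕ) : RamEnv (Σ a, Fin (N a)) :=
  E.extend Sigma.fst fun e => e.2

/-- The address of the `j`-th register behind the input. -/
def reg (E : RamEnv α) (a : α) (j : ℕ) : ℕ := (E.input a).length + (j + 1)

/-- The memory `M` holds the input and has the variables in the registers `E.reg a j`, `j ∈ pos`. -/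
def Stores (E : RamEnv α) (pos : List ℕ) (a : α) (M : ℕ → ℕ) : Prop :=
  (∀ i ≤ (E.input a).length, M i = ramInput (E.input a) i) ∧
    pos.map (fun j => M (E.reg a j)) = E.vars a

variable {E : RamEnv α} {π : β → α} {v : β → ℕ} {pos : List ℕ}

theorem size_extend (b : β) : (E.extend π v).size b = E.size (π b) + (v b).size + 1 := by
  simp only [size, extend, ramInputSize, List.map_cons, List.sum_cons]
  omega

theorem length_input_le_size (a : α) : (E.input a).length ≤ E.size a :=
  (length_le_ramInputSize _).trans (Nat.le_add_right ..)

theorem size_le_size_extend (b : β) : E.size (π b) ≤ (E.extend π v).size b := by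
  rw [size_extend]
  omega

theorem size_le_size_extend_top (b : β) : (v b).size ≤ (E.extend π v).size b := by
  rw [size_extend]
  omega

theorem polyBounded_size_comp : PolyBounded (E.extend π v).size fun b => E.size (π b) :=
  .of_le size_le_size_extend

theorem polyBounded_extend {f : α → ℕ} (hf : PolyBounded E.size f) :
    PolyBounded (E.extend π v).size fun b => f (π b) :=
  polyBounded_size_comp.trans (hf.comp π)

theorem polyBounded_size_extend (hv : PolyBounded (fun b => E.size (π b)) fun b => (v b).size) :
    PolyBounded (fun b => E.size (π b)) (E.extend π v).size :=
  ((PolyBounded.refl.add hv).add (.const 1)).mono fun b => (size_extend b).le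

theorem polyBounded_size_bind {N : α → ℕ} (hN : PolyBounded E.size N) :
    PolyBounded (fun e : Σ a, Fin (N a) => E.size e.1) (E.bind N).size :=
  have hi : PolyBounded (fun e : Σ a, Fin (N a) => E.size e.1) fun e => (e.2 : ℕ) :=
    (hN.comp _).mono fun e => e.2.2.le
  polyBounded_size_extend hi.size

theorem stores_extend_nil {b : β} {M : ℕ → ℕ} : ¬ (E.extend π v).Stores [] b M := by
  simp [Stores, extend]

theorem stores_extend_cons {j : ℕ} {b : β} {M : ℕ → ℕ} :
    (E.extend π v).Stores (j :: pos) b M ↔ M (E.reg (π b) j) = v b ∧ E.Stores pos (π b) M := by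
  simp only [Stores, extend, reg, List.map_cons, List.cons.injEq]
  tauto

theorem Stores.congr {a : α} {M M' : ℕ → ℕ} {r : ℕ} (h : E.Stores pos a M)
    (hr : ∀ j ∈ pos, j < r) (hM : ∀ i < E.reg a r, M' i = M i) : E.Stores pos a M' := by
  refine ⟨fun i hi => (hM i (by unfold reg; omega)).trans (h.1 i hi), ?_⟩
  rw [← h.2]
  refine List.map_congr_left fun j hj => hM _ ?_
  have := hr j hj
  unfold reg
  omega

theorem Stores.length_eq {a : α} {M : ℕ → ℕ} (h : E.Stores pos a M) :
    M 0 = (E.input a).length := h.1 0 (Nat.zero_le _)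

/-! ### Expressions over an environment -/

/-- The expression for the address of the `j`-th register behind the input, whose length is in
register `0`. -/
def regAddr (j : ℕ) : RamExpr := .add (.load (.lit 0)) (.lit (j + 1))

theorem polyEval_regAddr {X : Type*} {s : X → ℕ} {H : X → (ℕ → ℕ) → Prop} {φ : X → α}
    (hs : PolyBounded s fun x => E.size (φ x))
    (hH : ∀ x M, H x M → M 0 = (E.input (φ x)).length) (j : ℕ) :
    PolyEval s H (regAddr j) fun x => E.reg (φ x) j :=
  .add (.load (.lit 0) (hs.mono fun x => length_input_le_size (φ x)).size hH) (.lit _)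

theorem polyEval_load_regAddr {X : Type*} {s : X → ℕ} {H : X → (ℕ → ℕ) → Prop} {φ : X → α}
    {w : X → ℕ} (hs : PolyBounded s fun x => E.size (φ x))
    (hH : ∀ x M, H x M → M 0 = (E.input (φ x)).length) {j : ℕ}
    (hw : PolyBounded s fun x => (w x).size) (hM : ∀ x M, H x M → M (E.reg (φ x) j) = w x) :
    PolyEval s H (.load (regAddr j)) w :=
  .load (polyEval_regAddr hs hH j) hw hM

/-- The value `f` is given by an expression in the input and the variables, wherever the variables
are stored. -/
def PolyExpr (E : RamEnv α) (f : α → ℕ) : Prop :=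
  ∀ pos, ∃ e, PolyEval E.size (E.Stores pos) e f

namespace PolyExpr

variable {f g : α → ℕ}

theorem const (n : ℕ) : E.PolyExpr fun _ => n := fun _ => ⟨_, .lit n⟩

theorem top : (E.extend π v).PolyExpr v
  | [] => ⟨.lit 0, .of_forall_not fun _ _ => stores_extend_nil⟩
  | j :: _ => ⟨.load (regAddr j), polyEval_load_regAddr polyBounded_size_comp
      (fun _ _ h => (stores_extend_cons.1 h).2.length_eq)
      (.of_le size_le_size_extend_top) fun _ _ h => (stores_extend_cons.1 h).1⟩

theorem extend (hf : E.PolyExpr f) : (E.extend π v).PolyExpr fun b => f (π b)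
  | [] => ⟨.lit 0, .of_forall_not fun _ _ => stores_extend_nil⟩
  | _ :: pos => (hf pos).imp fun _ he => he.conseq π polyBounded_size_comp
      (fun _ _ h => (stores_extend_cons.1 h).2) fun _ => rfl

theorem add (hf : E.PolyExpr f) (hg : E.PolyExpr g) : E.PolyExpr fun a => f a + g a := fun pos =>
  let ⟨_, hd⟩ := hf pos
  let ⟨_, he⟩ := hg pos
  ⟨_, hd.add he⟩

theorem sub (hf : E.PolyExpr f) (hg : E.PolyExpr g) : E.PolyExpr fun a => f a - g a := fun pos =>
  let ⟨_, hd⟩ := hf pos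
  let ⟨_, he⟩ := hg pos
  ⟨_, hd.sub he⟩

theorem mul (hf : E.PolyExpr f) (hg : E.PolyExpr g) : E.PolyExpr fun a => f a * g a := fun pos =>
  let ⟨_, hd⟩ := hf pos
  let ⟨_, he⟩ := hg pos
  ⟨_, hd.mul he⟩

theorem read (hf : E.PolyExpr f) (hle : ∀ a, f a ≤ (E.input a).length) :
    E.PolyExpr fun a => ramInput (E.input a) (f a) := fun pos =>
  let ⟨_, he⟩ := hf pos
  ⟨_, .load he (.of_le fun _ => (size_ramInput_le _ _).trans (Nat.le_add_right ..))
    fun _ _ hM => hM.1 _ (hle _)⟩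

end PolyExpr

/-! ### Subroutines -/

/-- The value `f` is computable in polynomial time: wherever the variables are stored below the
`r`-th register behind the input, a subroutine writes `f` to this register and does not change the
memory below it. The registers from there on are its work space. -/
def PolyTime (E : RamEnv α) (f : α → ℕ) : Prop :=
  PolyBounded E.size (fun a => (f a).size) ∧
    ∀ pos r, (∀ j ∈ pos, j < r) → ∃ p,
      PolyTriple (fun x : α × (ℕ → ℕ) => E.size x.1)
        (fun x M => M = x.2 ∧ E.Stores pos x.1 M) p
        fun x M => M (E.reg x.1 r) = f x.1 ∧ ∀ i < E.reg x.1 r, M i = x.2 i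

theorem polyTriple_store_reg {X : Type*} {s : X → ℕ} {H H' : X → (ℕ → ℕ) → Prop} {φ : X → α}
    {e : RamExpr} {w : X → ℕ} (r : ℕ) (hs : PolyBounded s fun x => E.size (φ x))
    (hH : ∀ x M, H x M → M 0 = (E.input (φ x)).length) (he : PolyEval s H e w)
    (hH' : ∀ x M M', H x M → M' (E.reg (φ x) r) = w x →
      (∀ i ≠ E.reg (φ x) r, M' i = M i) → H' x M') :
    PolyTriple s H (.store (regAddr r) e) H' :=
  .store (polyEval_regAddr hs hH r) he fun x M hM =>
    hH' x M _ hM (Function.update_self ..) fun _ hi => Function.update_of_ne hi ..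

namespace PolyTime

variable {f g : α → ℕ}

theorem of_expr (hsize : PolyBounded E.size fun a => (f a).size) (hf : E.PolyExpr f) :
    E.PolyTime f := by
  refine ⟨hsize, fun pos r _ => ?_⟩
  obtain ⟨e, he⟩ := hf pos
  refine ⟨_, polyTriple_store_reg r .refl (fun x M hM => hM.2.length_eq)
    (he.conseq Prod.fst .refl (fun x M hM => hM.2) fun _ => rfl) ?_⟩
  rintro x M M' ⟨rfl, -⟩ hr hne
  exact ⟨hr, fun i hi => hne i hi.ne⟩

theorem const (n : ℕ) : E.PolyTime fun _ => n := .of_expr (.const _) (.const n)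

theorem top : (E.extend π v).PolyTime v :=
  .of_expr (.of_le size_le_size_extend_top) .top

theorem exists_polyTriple (hf : E.PolyTime f) {r : ℕ} (hr : ∀ j ∈ pos, j < r) :
    ∃ p, ∀ {X : Type*} {s : X → ℕ} {H H' : X → (ℕ → ℕ) → Prop} {φ : X → α},
      PolyBounded s (fun x => E.size (φ x)) → (∀ x M, H x M → E.Stores pos (φ x) M) →
      (∀ x M M', H x M → M' (E.reg (φ x) r) = f (φ x) →
        (∀ i < E.reg (φ x) r, M' i = M i) → H' x M') → PolyTriple s H p H' := by
  obtain ⟨p, hp⟩ := hf.2 pos r hr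
  exact ⟨p, fun hs hH hH' => hp.conseq (fun x M => (_, M)) hs (fun _ _ _ => le_rfl)
    (fun x M hM => ⟨rfl, hH x M hM⟩) fun x M M' hM hM' => hH' x M M' hM hM'.1 hM'.2⟩

theorem extend (hf : E.PolyTime f) : (E.extend π v).PolyTime fun b => f (π b) := by
  refine ⟨polyBounded_extend hf.1, fun pos r hr => ?_⟩
  cases pos with
  | nil => exact ⟨.skip, _, .const 0, fun x M hM => (stores_extend_nil hM.2).elim⟩
  | cons j pos =>
    obtain ⟨p, hp⟩ := hf.exists_polyTriple fun i hi => hr i (List.mem_cons_of_mem j hi)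
    refine ⟨p, hp (polyBounded_size_comp.comp Prod.fst)
      (fun x M hM => (stores_extend_cons.1 hM.2).2) ?_⟩
    rintro x M M' ⟨rfl, -⟩ hr' hlt
    exact ⟨hr', hlt⟩

theorem of_push (hg : E.PolyTime g) (hf : (E.push g).PolyTime f) : E.PolyTime f := by
  have hgs : PolyBounded E.size (E.push g).size := polyBounded_size_extend hg.1
  have hfs : PolyBounded E.size fun a => (f a).size := hgs.trans hf.1
  refine ⟨hfs, fun pos r hr => ?_⟩
  obtain ⟨p, hp⟩ := hg.exists_polyTriple hr
  obtain ⟨q, hq⟩ := hf.exists_polyTriple (pos := r :: pos) (r := r + 1) fun j hj => by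
    rcases List.mem_cons.1 hj with rfl | hj
    · omega
    · exact (hr j hj).trans (Nat.lt_succ_self r)
  have hp' : PolyTriple (fun x : α × (ℕ → ℕ) => E.size x.1)
      (fun x M => M = x.2 ∧ E.Stores pos x.1 M) p
      fun x M => (E.push g).Stores (r :: pos) x.1 M ∧ ∀ i < E.reg x.1 r, M i = x.2 i := by
    refine hp .refl (fun _ _ hM => hM.2) ?_
    rintro x M M' ⟨rfl, hM⟩ hr' hlt
    exact ⟨stores_extend_cons.2 ⟨hr', hM.congr hr hlt⟩, hlt⟩
  have hq' : PolyTriple (fun x : α × (ℕ → ℕ) => E.size x.1)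
      (fun x M => (E.push g).Stores (r :: pos) x.1 M ∧ ∀ i < E.reg x.1 r, M i = x.2 i) q
      fun x M => M (E.reg x.1 (r + 1)) = f x.1 ∧ M 0 = (E.input x.1).length ∧
        ∀ i < E.reg x.1 r, M i = x.2 i := by
    refine hq (hgs.comp Prod.fst) (fun _ _ hM => hM.1) ?_
    rintro x M M' ⟨hM, hlt⟩ hr' hlt'
    exact ⟨hr', (hlt' 0 (Nat.succ_pos _)).trans hM.length_eq,
      fun i hi => (hlt' i (hi.trans (by simp [reg, RamEnv.extend]))).trans (hlt i hi)⟩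
  refine ⟨_, hp'.seq (hq'.seq (polyTriple_store_reg r .refl (fun _ _ hM => hM.2.1)
    (polyEval_load_regAddr .refl (fun _ _ hM => hM.2.1) (hfs.comp Prod.fst)
      fun _ _ hM => hM.1) ?_))⟩
  rintro x M M' ⟨-, -, hlt⟩ hr' hne
  exact ⟨hr', fun i hi => (hne i hi.ne).trans (hlt i hi)⟩

end PolyTime

/-! ### Bounded recursion -/

variable {r : ℕ}

theorem reg_lt_reg_iff {a : α} {j k : ℕ} : E.reg a j < E.reg a k ↔ j < k := by
  unfold reg
  omega

theorem reg_inj {a : α} {j k : ℕ} : E.reg a j = E.reg a k ↔ j = k := by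
  unfold reg
  omega

/-- The memory during a bounded recursion that was started in the memory `x.2`: the accumulator, the
number of iterations and the loop counter are in the `r`-th register and the next two. -/
structure LoopState (E : RamEnv α) (pos : List ℕ) (r n : ℕ) (x : α × (ℕ → ℕ)) (acc i : ℕ)
    (M : ℕ → ℕ) : Prop where
  stores : E.Stores pos x.1 M
  unchanged : ∀ k < E.reg x.1 r, M k = x.2 k
  acc_eq : M (E.reg x.1 r) = acc
  bound_eq : M (E.reg x.1 (r + 1)) = n
  counter_eq : M (E.reg x.1 (r + 2)) = i

namespace LoopState

variable {n acc i v : ℕ} {x : α × (ℕ → ℕ)} {M M' : ℕ → ℕ}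

theorem of_eq_below (h : E.LoopState pos r n x acc i M) (hr : ∀ j ∈ pos, j < r)
    (hM : ∀ k < E.reg x.1 (r + 3), M' k = M k) : E.LoopState pos r n x acc i M' where
  stores := h.stores.congr (fun j hj => (hr j hj).trans (by omega)) hM
  unchanged k hk := (hM k (hk.trans (reg_lt_reg_iff.2 (by omega)))).trans (h.unchanged k hk)
  acc_eq := (hM _ (reg_lt_reg_iff.2 (by omega))).trans h.acc_eq
  bound_eq := (hM _ (reg_lt_reg_iff.2 (by omega))).trans h.bound_eq
  counter_eq := (hM _ (reg_lt_reg_iff.2 (by omega))).trans h.counter_eq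

theorem set_acc (h : E.LoopState pos r n x acc i M) (hr : ∀ j ∈ pos, j < r)
    (hv : M' (E.reg x.1 r) = v) (hM : ∀ k ≠ E.reg x.1 r, M' k = M k) :
    E.LoopState pos r n x v i M' where
  stores := h.stores.congr hr fun k hk => hM k hk.ne
  unchanged k hk := (hM k hk.ne).trans (h.unchanged k hk)
  acc_eq := hv
  bound_eq := (hM _ (by simp [reg_inj])).trans h.bound_eq
  counter_eq := (hM _ (by simp [reg_inj])).trans h.counter_eq

theorem set_counter (h : E.LoopState pos r n x acc i M) (hr : ∀ j ∈ pos, j < r)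
    (hv : M' (E.reg x.1 (r + 2)) = v) (hM : ∀ k ≠ E.reg x.1 (r + 2), M' k = M k) :
    E.LoopState pos r n x acc v M' where
  stores := h.stores.congr (fun j hj => (hr j hj).trans (by omega)) fun k hk => hM k hk.ne
  unchanged k hk := (hM k (hk.trans (reg_lt_reg_iff.2 (by omega))).ne).trans (h.unchanged k hk)
  acc_eq := (hM _ (by simp [reg_inj])).trans h.acc_eq
  bound_eq := (hM _ (by simp [reg_inj])).trans h.bound_eq
  counter_eq := hv

theorem length_eq (h : E.LoopState pos r n x acc i M) : M 0 = (E.input x.1).length :=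
  h.stores.length_eq

end LoopState

variable {N : α → ℕ} {F : α → ℕ → ℕ}

theorem exists_polyTriple_start (hr : ∀ j ∈ pos, j < r) (hN : E.PolyTime N)
    (h0 : E.PolyTime fun a => F a 0) : ∃ p,
      PolyTriple (fun x : α × (ℕ → ℕ) => E.size x.1) (fun x M => M = x.2 ∧ E.Stores pos x.1 M) p
        fun x M => E.LoopState pos r (N x.1) x (F x.1 0) 0 M := by
  obtain ⟨p, hp⟩ := h0.exists_polyTriple hr
  obtain ⟨q, hq⟩ := hN.exists_polyTriple fun j hj => (hr j hj).trans r.lt_succ_self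
  have hp' : PolyTriple (fun x : α × (ℕ → ℕ) => E.size x.1)
      (fun x M => M = x.2 ∧ E.Stores pos x.1 M) p
      fun x M => E.Stores pos x.1 M ∧ (∀ k < E.reg x.1 r, M k = x.2 k) ∧
        M (E.reg x.1 r) = F x.1 0 := by
    refine hp .refl (fun _ _ hM => hM.2) ?_
    rintro x M M' ⟨rfl, hM⟩ hacc hlt
    exact ⟨hM.congr hr hlt, hlt, hacc⟩
  have hq' : PolyTriple (fun x : α × (ℕ → ℕ) => E.size x.1)
      (fun x M => E.Stores pos x.1 M ∧ (∀ k < E.reg x.1 r, M k = x.2 k) ∧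
        M (E.reg x.1 r) = F x.1 0) q
      fun x M => E.LoopState pos r (N x.1) x (F x.1 0) (M (E.reg x.1 (r + 2))) M := by
    refine hq .refl (fun _ _ hM => hM.1) ?_
    rintro x M M' ⟨hM, hlt, hacc⟩ hbound hlt'
    have hlt_succ : E.reg x.1 r < E.reg x.1 (r + 1) := reg_lt_reg_iff.2 r.lt_succ_self
    exact ⟨hM.congr (fun j hj => (hr j hj).trans r.lt_succ_self) hlt',
      fun k hk => (hlt' k (hk.trans hlt_succ)).trans (hlt k hk),
      (hlt' _ hlt_succ).trans hacc, hbound, rfl⟩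
  exact ⟨_, hp'.seq (hq'.seq (polyTriple_store_reg (r + 2) .refl (fun _ _ hM => hM.length_eq)
    (.lit 0) fun _ _ _ hM hv hne => hM.set_counter hr hv hne))⟩

theorem exists_polyTriple_step (hr : ∀ j ∈ pos, j < r) (hN : PolyBounded E.size N)
    (hF : PolyBounded (fun e : Σ a, Fin (N a + 1) => E.size e.1) fun e => (F e.1 e.2).size)
    (hstep : ((E.bind N).push fun e => F e.1 e.2).PolyTime fun e => F e.1 (e.2 + 1)) : ∃ p,
      PolyTriple (fun y : Σ x : α × (ℕ → ℕ), Fin (N x.1) => E.size y.1.1)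
        (fun y M => E.LoopState pos r (N y.1.1) y.1 (F y.1.1 y.2) y.2 M) p
        fun y M => E.LoopState pos r (N y.1.1) y.1 (F y.1.1 y.2) y.2 M ∧
          M (E.reg y.1.1 (r + 3)) = F y.1.1 (y.2 + 1) := by
  obtain ⟨p, hp⟩ := hstep.exists_polyTriple (pos := r :: (r + 2) :: pos) (r := r + 3) fun j hj => by
    rcases List.mem_cons.1 hj with rfl | hj
    · omega
    rcases List.mem_cons.1 hj with rfl | hj
    · omega
    · exact (hr j hj).trans (by omega)
  let forgetMemory (y : Σ x : α × (ℕ → ℕ), Fin (N x.1)) : Σ a, Fin (N a) := ⟨y.1.1, y.2⟩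
  have hacc : PolyBounded (fun e : Σ a, Fin (N a) => E.size e.1) fun e => (F e.1 e.2).size :=
    hF.comp fun e : Σ a, Fin (N a) => ⟨e.1, e.2.castSucc⟩
  have hsize : PolyBounded (fun e : Σ a, Fin (N a) => E.size e.1)
      ((E.bind N).push fun e => F e.1 e.2).size :=
    (polyBounded_size_bind hN).trans (polyBounded_size_extend (polyBounded_size_comp.trans hacc))
  exact ⟨p, hp (φ := forgetMemory) (hsize.comp forgetMemory)
    (fun y M hM => stores_extend_cons.2
      ⟨hM.acc_eq, stores_extend_cons.2 ⟨hM.counter_eq, hM.stores⟩⟩)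
    fun y M M' hM hv hlt => ⟨hM.of_eq_below hr hlt, hv⟩⟩

theorem exists_polyTriple_iterate (hr : ∀ j ∈ pos, j < r) (hN : PolyBounded E.size N)
    (hF : PolyBounded (fun e : Σ a, Fin (N a + 1) => E.size e.1) fun e => (F e.1 e.2).size)
    (hstep : ((E.bind N).push fun e => F e.1 e.2).PolyTime fun e => F e.1 (e.2 + 1)) : ∃ p,
      PolyTriple (fun y : Σ x : α × (ℕ → ℕ), Fin (N x.1) => E.size y.1.1)
        (fun y M => E.LoopState pos r (N y.1.1) y.1 (F y.1.1 y.2) y.2 M) p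
        fun y M => E.LoopState pos r (N y.1.1) y.1 (F y.1.1 (y.2 + 1)) (y.2 + 1) M := by
  obtain ⟨p, hp⟩ := exists_polyTriple_step hr hN hF hstep
  have hacc : PolyBounded (fun y : Σ x : α × (ℕ → ℕ), Fin (N x.1) => E.size y.1.1)
      fun y => (F y.1.1 (y.2 + 1)).size :=
    hF.comp fun y : Σ x : α × (ℕ → ℕ), Fin (N x.1) => ⟨y.1.1, y.2.succ⟩
  have hi : PolyBounded (fun y : Σ x : α × (ℕ → ℕ), Fin (N x.1) => E.size y.1.1)
      fun y => (y.2 : ℕ).size := ((hN.comp _).mono fun y => y.2.2.le).size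
  refine ⟨_, hp.seq (.seq (H' := fun y M =>
      E.LoopState pos r (N y.1.1) y.1 (F y.1.1 (y.2 + 1)) y.2 M)
    (polyTriple_store_reg r .refl (fun _ _ hM => hM.1.length_eq)
      (polyEval_load_regAddr .refl (fun _ _ hM => hM.1.length_eq) hacc fun _ _ hM => hM.2)
      fun y M M' hM hv hne => hM.1.set_acc hr hv hne)
    (polyTriple_store_reg (r + 2) .refl (fun _ _ hM => hM.length_eq)
      ((polyEval_load_regAddr .refl (fun _ _ hM => hM.length_eq) hi
        fun _ _ hM => hM.counter_eq).add (.lit 1))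
      fun y M M' hM hv hne => hM.set_counter hr hv hne))⟩

namespace PolyTime

theorem recursion (hN : E.PolyTime N) (hNb : PolyBounded E.size N)
    (hF : PolyBounded (fun e : Σ a, Fin (N a + 1) => E.size e.1) fun e => (F e.1 e.2).size)
    (h0 : E.PolyTime fun a => F a 0)
    (hstep : ((E.bind N).push fun e => F e.1 e.2).PolyTime fun e => F e.1 (e.2 + 1)) :
    E.PolyTime fun a => F a (N a) := by
  refine ⟨hF.comp fun a => ⟨a, Fin.last (N a)⟩, fun pos r hr => ?_⟩
  obtain ⟨p, hp⟩ := exists_polyTriple_start hr hN h0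
  obtain ⟨q, hq⟩ := exists_polyTriple_iterate hr hNb hF hstep
  have hloop : PolyTriple (fun x : α × (ℕ → ℕ) => E.size x.1)
      (fun x M => E.LoopState pos r (N x.1) x (F x.1 0) 0 M)
      (.loop (.sub (.load (regAddr (r + 1))) (.load (regAddr (r + 2)))) q)
      fun x M => E.LoopState pos r (N x.1) x (F x.1 (N x.1)) (N x.1) M := by
    refine .loop (I := fun x i M => E.LoopState pos r (N x.1) x (F x.1 i) i M)
      (hNb.comp Prod.fst) ?_ hq
    have hbound : PolyBounded (fun y : Σ x : α × (ℕ → ℕ), Fin (N x.1 + 1) => E.size y.1.1)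
        fun y => N y.1.1 := hNb.comp _
    exact .sub
      (polyEval_load_regAddr .refl (fun _ _ hM => hM.length_eq) hbound.size
        fun _ _ hM => hM.bound_eq)
      (polyEval_load_regAddr .refl (fun _ _ hM => hM.length_eq)
        (hbound.mono fun y => Nat.lt_succ_iff.1 y.2.2).size fun _ _ hM => hM.counter_eq)
  exact ⟨_, (hp.seq hloop).conseq (fun x _ => x) .refl (fun _ _ _ => le_rfl) (fun _ _ hM => hM)
    fun x M M' _ hM' => ⟨hM'.acc_eq, hM'.unchanged⟩⟩

end PolyTime

/-! ### Polynomial time arithmetic -/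

variable {f g : α → ℕ}

/-- The value `f` is computable in polynomial time and is itself polynomially bounded, so that it
may serve as an exponent or as the number of iterations of a loop. -/
structure PolyTimeUnary (E : RamEnv α) (f : α → ℕ) : Prop where
  polyTime : E.PolyTime f
  polyBounded : PolyBounded E.size f

namespace PolyTime

theorem congr (hf : E.PolyTime f) (hfg : ∀ a, f a = g a) : E.PolyTime g := funext hfg ▸ hf

theorem add (hf : E.PolyTime f) (hg : E.PolyTime g) : E.PolyTime fun a => f a + g a :=
  hf.of_push <| hg.extend.of_push <| of_expr
    (polyBounded_extend <| polyBounded_extend <|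
      ((hf.1.add hg.1).add (.const 1)).mono fun a => natSize_add_le (f a) (g a))
    (.add PolyExpr.top.extend .top)

theorem sub (hf : E.PolyTime f) (hg : E.PolyTime g) : E.PolyTime fun a => f a - g a :=
  hf.of_push <| hg.extend.of_push <| of_expr
    (polyBounded_extend <| polyBounded_extend <|
      hf.1.mono fun a => Nat.size_le_size (Nat.sub_le (f a) (g a)))
    (.sub PolyExpr.top.extend .top)

theorem mul (hf : E.PolyTime f) (hg : E.PolyTime g) : E.PolyTime fun a => f a * g a :=
  hf.of_push <| hg.extend.of_push <| of_expr
    (polyBounded_extend <| polyBounded_extend <|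
      (hf.1.add hg.1).mono fun a => natSize_mul_le (f a) (g a))
    (.mul PolyExpr.top.extend .top)

theorem read (hf : E.PolyTime f) (hle : ∀ a, f a ≤ (E.input a).length) :
    E.PolyTime fun a => ramInput (E.input a) (f a) :=
  hf.of_push <| of_expr
    (polyBounded_extend <| .of_le fun _ => (size_ramInput_le _ _).trans (Nat.le_add_right ..))
    (PolyExpr.read .top hle)

theorem finset_sum {ι : Type*} (s : Finset ι) {F : ι → α → ℕ} (hF : ∀ i ∈ s, E.PolyTime (F i)) :
    E.PolyTime fun a => ∑ i ∈ s, F i a := by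
  classical
  induction s using Finset.induction with
  | empty => exact const 0
  | insert i s hi ih =>
    simp only [Finset.sum_insert hi]
    exact (hF i (s.mem_insert_self i)).add (ih fun k hk => hF k (Finset.mem_insert_of_mem hk))

end PolyTime

namespace PolyTimeUnary

theorem const (n : ℕ) : E.PolyTimeUnary fun _ => n := ⟨.const n, .const n⟩

theorem add (hf : E.PolyTimeUnary f) (hg : E.PolyTimeUnary g) :
    E.PolyTimeUnary fun a => f a + g a := ⟨hf.1.add hg.1, hf.2.add hg.2⟩

theorem sub (hf : E.PolyTimeUnary f) (hg : E.PolyTimeUnary g) :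
    E.PolyTimeUnary fun a => f a - g a :=
  ⟨hf.1.sub hg.1, hf.2.mono fun _ => Nat.sub_le ..⟩

theorem mul (hf : E.PolyTimeUnary f) (hg : E.PolyTimeUnary g) :
    E.PolyTimeUnary fun a => f a * g a := ⟨hf.1.mul hg.1, hf.2.mul hg.2⟩

theorem pow_const (hf : E.PolyTimeUnary f) (k : ℕ) : E.PolyTimeUnary fun a => f a ^ k := by
  induction k with
  | zero => exact const 1
  | succ k ih => exact ih.mul hf

theorem finset_sum {ι : Type*} (s : Finset ι) {F : ι → α → ℕ}
    (hF : ∀ i ∈ s, E.PolyTimeUnary (F i)) : E.PolyTimeUnary fun a => ∑ i ∈ s, F i a := by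
  classical
  induction s using Finset.induction with
  | empty => exact const 0
  | insert i s hi ih =>
    simp only [Finset.sum_insert hi]
    exact (hF i (s.mem_insert_self i)).add (ih fun k hk => hF k (Finset.mem_insert_of_mem hk))

theorem extend (hf : E.PolyTimeUnary f) : (E.extend π v).PolyTimeUnary fun b => f (π b) :=
  ⟨hf.1.extend, polyBounded_extend hf.2⟩

theorem index (hN : PolyBounded E.size N) : (E.bind N).PolyTimeUnary fun e => e.2 :=
  have h : PolyBounded (E.bind N).size fun e => (e.2 : ℕ) :=
    (polyBounded_extend hN).mono fun e => e.2.2.le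
  ⟨.top, h⟩

end PolyTimeUnary

theorem polyBounded_size_of_growth {F : α → ℕ → ℕ} {c : (Σ a, Fin (N a)) → ℕ}
    (hN : PolyBounded E.size N) (h0 : PolyBounded E.size fun a => (F a 0).size)
    (hc : PolyBounded (E.bind N).size c)
    (hF : ∀ e : Σ a, Fin (N a), (F e.1 (e.2 + 1)).size ≤ (F e.1 e.2).size + c e) :
    PolyBounded (fun e : Σ a, Fin (N a + 1) => E.size e.1) fun e => (F e.1 e.2).size := by
  obtain ⟨T, hT⟩ := (polyBounded_size_bind hN).trans hc
  have hbound : PolyBounded E.size fun a => (F a 0).size + N a * T.eval (E.size a) :=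
    h0.add (hN.mul ⟨T, fun _ => le_rfl⟩)
  refine (hbound.comp Sigma.fst).mono ?_
  suffices ∀ a, ∀ i ≤ N a, (F a i).size ≤ (F a 0).size + i * T.eval (E.size a) from fun e =>
    (this e.1 e.2 (Nat.lt_succ_iff.1 e.2.2)).trans <| Nat.add_le_add_left
      (Nat.mul_le_mul_right _ (Nat.lt_succ_iff.1 e.2.2)) _
  intro a i
  induction i with
  | zero => simp
  | succ i ih =>
    intro hi
    have hstep := hF ⟨a, i, hi⟩
    have hT' := hT ⟨a, i, hi⟩
    have := ih (Nat.le_of_succ_le hi)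
    rw [add_mul, one_mul]
    dsimp only at hstep hT'
    omega

namespace PolyTime

theorem sum {g : (Σ a, Fin (N a)) → ℕ} (hN : E.PolyTimeUnary N) (hg : (E.bind N).PolyTime g) :
    E.PolyTime fun a => ∑ i, g ⟨a, i⟩ := by
  simp only [Finset.sum_fin_eq_sum_range]
  let F (a : α) (k : ℕ) : ℕ := ∑ i ∈ Finset.range k, if h : i < N a then g ⟨a, i, h⟩ else 0
  have hF (e : Σ a, Fin (N a)) : F e.1 (e.2 + 1) = F e.1 e.2 + g e := by
    simp [F, Finset.sum_range_succ]
  refine recursion (F := F) hN.1 hN.2 (polyBounded_size_of_growth hN.2 (const 0).1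
    (hg.1.add (.const 1)) fun e => ?_) (const 0) ((top.add hg.extend).congr fun e => (hF e).symm)
  rw [hF]
  exact natSize_add_le ..

theorem prod {g : (Σ a, Fin (N a)) → ℕ} (hN : E.PolyTimeUnary N) (hg : (E.bind N).PolyTime g) :
    E.PolyTime fun a => ∏ i, g ⟨a, i⟩ := by
  simp only [Finset.prod_fin_eq_prod_range]
  let F (a : α) (k : ℕ) : ℕ := ∏ i ∈ Finset.range k, if h : i < N a then g ⟨a, i, h⟩ else 1
  have hF (e : Σ a, Fin (N a)) : F e.1 (e.2 + 1) = F e.1 e.2 * g e := by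
    simp [F, Finset.prod_range_succ]
  refine recursion (F := F) hN.1 hN.2 (polyBounded_size_of_growth hN.2 (const 1).1
    hg.1 fun e => ?_) (const 1) ((top.mul hg.extend).congr fun e => (hF e).symm)
  rw [hF]
  exact natSize_mul_le ..

theorem pow (hf : E.PolyTime f) (hg : E.PolyTimeUnary g) : E.PolyTime fun a => f a ^ g a :=
  (prod hg hf.extend).congr fun a => by simp

theorem factorial (hf : E.PolyTimeUnary f) : E.PolyTime fun a => (f a).factorial :=
  (prod hf ((PolyTimeUnary.index hf.2).1.add (const 1))).congr fun a => by
    rw [Fin.prod_univ_eq_prod_range (· + 1), Finset.prod_range_add_one_eq_factorial]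

end PolyTime

/-! ### Predicates -/

/-- The predicate `P` is decidable in polynomial time: it holds if and only if some polynomial time
computable number is nonzero. -/
def PolyTimePred (E : RamEnv α) (P : α → Prop) : Prop :=
  ∃ f, E.PolyTime f ∧ ∀ a, P a ↔ f a ≠ 0

namespace PolyTimePred

variable {P Q : α → Prop}

theorem congr (hP : E.PolyTimePred P) (hPQ : ∀ a, P a ↔ Q a) : E.PolyTimePred Q :=
  funext (fun a => propext (hPQ a)) ▸ hP

theorem polyTime_ite [DecidablePred P] (hP : E.PolyTimePred P) (hf : E.PolyTime f)
    (hg : E.PolyTime g) : E.PolyTime fun a => if P a then f a else g a := by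
  obtain ⟨b, hb, hPb⟩ := hP
  refine ((((PolyTime.const 1).sub ((PolyTime.const 1).sub hb)).mul hf).add
    (((PolyTime.const 1).sub hb).mul hg)).congr fun a => ?_
  by_cases hb0 : b a = 0
  · simp [hPb, hb0]
  · have : 1 - b a = 0 := by omega
    simp [hPb, hb0, this]

theorem lt (hf : E.PolyTime f) (hg : E.PolyTime g) : E.PolyTimePred fun a => f a < g a :=
  ⟨_, hg.sub hf, fun a => by omega⟩

theorem not (hP : E.PolyTimePred P) : E.PolyTimePred fun a => ¬ P a :=
  let ⟨f, hf, hPf⟩ := hP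
  ⟨_, (PolyTime.const 1).sub hf, fun a => by simp only [hPf]; omega⟩

theorem and (hP : E.PolyTimePred P) (hQ : E.PolyTimePred Q) : E.PolyTimePred fun a => P a ∧ Q a :=
  let ⟨_, hf, hPf⟩ := hP
  let ⟨_, hg, hQg⟩ := hQ
  ⟨_, hf.mul hg, fun a => by simp only [hPf, hQg, mul_ne_zero_iff]⟩

theorem or (hP : E.PolyTimePred P) (hQ : E.PolyTimePred Q) : E.PolyTimePred fun a => P a ∨ Q a :=
  (hP.not.and hQ.not).not.congr fun a => by tauto

theorem iff (hP : E.PolyTimePred P) (hQ : E.PolyTimePred Q) :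
    E.PolyTimePred fun a => P a ↔ Q a :=
  ((hP.and hQ).or (hP.not.and hQ.not)).congr fun a => by tauto

theorem le (hf : E.PolyTime f) (hg : E.PolyTime g) : E.PolyTimePred fun a => f a ≤ g a :=
  (lt hg hf).not.congr fun _ => not_lt

theorem eq (hf : E.PolyTime f) (hg : E.PolyTime g) : E.PolyTimePred fun a => f a = g a :=
  ((le hf hg).and (le hg hf)).congr fun _ => le_antisymm_iff.symm

theorem exists_fin {P : (Σ a, Fin (N a)) → Prop} (hN : E.PolyTimeUnary N)
    (hP : (E.bind N).PolyTimePred P) : E.PolyTimePred fun a => ∃ i, P ⟨a, i⟩ :=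
  let ⟨f, hf, hPf⟩ := hP
  ⟨_, .sum hN hf, fun a => by simp [hPf]⟩

theorem exists_of_finite {ι : Type*} [Finite ι] {P : ι → α → Prop}
    (hP : ∀ i, E.PolyTimePred (P i)) : E.PolyTimePred fun a => ∃ i, P i a := by
  have := Fintype.ofFinite ι
  choose f hf hPf using hP
  exact ⟨_, .finset_sum Finset.univ fun i _ => hf i, fun a => by simp [hPf]⟩

theorem polyTime_card {S : ∀ a, Finset (Fin (N a))} (hN : E.PolyTimeUnary N)
    (hS : (E.bind N).PolyTimePred fun e => e.2 ∈ S e.1) : E.PolyTime fun a => (S a).card := by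
  have hsum : E.PolyTime fun a => ∑ i, if i ∈ S a then 1 else 0 :=
    .sum hN (hS.polyTime_ite (.const 1) (.const 0))
  exact hsum.congr fun a => by simp

end PolyTimePred

/-! ### Division -/

theorem div_eq_two_mul_div_add (n d : ℕ) :
    n / d = 2 * (n / (2 * d)) + if 0 < d ∧ d * (2 * (n / (2 * d)) + 1) ≤ n then 1 else 0 := by
  rcases Nat.eq_zero_or_pos d with rfl | hd
  · simp
  rw [mul_comm 2 d, ← Nat.div_div_eq_div_mul]
  simp only [hd, true_and, mul_comm d, ← Nat.le_div_iff_mul_le hd]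
  split_ifs <;> omega

namespace PolyTime

/-- Long division: the `i`-th partial quotient is `f / (g * 2 ^ (K - i))`. -/
theorem div {K : α → ℕ} (hf : E.PolyTime f) (hg : E.PolyTime g) (hK : E.PolyTimeUnary K)
    (hlt : ∀ a, f a < 2 ^ K a) : E.PolyTime fun a => f a / g a := by
  let q (a : α) (i : ℕ) : ℕ := f a / (g a * 2 ^ (K a - i))
  have h0 (a : α) : q a 0 = 0 := by
    rcases Nat.eq_zero_or_pos (g a) with hga | hga
    · simp [q, hga]
    · exact Nat.div_eq_of_lt ((hlt a).trans_le (Nat.le_mul_of_pos_left _ hga))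
  have hq (e : Σ a, Fin (K a)) : q e.1 e.2 =
      f e.1 / (2 * (g e.1 * 2 ^ (K e.1 - (e.2 + 1)))) := by
    have : K e.1 - e.2 = K e.1 - (e.2 + 1) + 1 := by omega
    simp only [q, this, pow_succ]
    ring_nf
  have hd : (E.bind K).PolyTime fun e => g e.1 * 2 ^ (K e.1 - (e.2 + 1)) :=
    hg.extend.mul ((const 2).pow (hK.extend.sub ((PolyTimeUnary.index hK.2).add (.const 1))))
  have hdouble : ((E.bind K).push fun e => q e.1 e.2).PolyTime fun e => 2 * q e.1 e.2 :=
    (const 2).mul top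
  refine (recursion (F := q) hK.1 hK.2 ((hf.1.comp Sigma.fst).mono fun e =>
    Nat.size_le_size (Nat.div_le_self ..)) ((const 0).congr fun a => (h0 a).symm) ?_).congr
      fun a => by simp [q]
  refine (hdouble.add (PolyTimePred.polyTime_ite (P := fun e => _ ∧ _)
    ((PolyTimePred.lt (const 0) hd.extend).and
      (.le (hd.extend.mul (hdouble.add (const 1))) hf.extend.extend)) (const 1) (const 0))).congr
    fun e => ?_
  simp only [id_eq, hq]
  exact (div_eq_two_mul_div_add _ _).symm

theorem mod {K : α → ℕ} (hf : E.PolyTime f) (hg : E.PolyTime g) (hK : E.PolyTimeUnary K)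
    (hlt : ∀ a, f a < 2 ^ K a) : E.PolyTime fun a => f a % g a :=
  (hf.sub (hg.mul (hf.div hg hK hlt))).congr fun _ => (Nat.mod_eq_sub_mul_div ..).symm

end PolyTime

theorem PolyTimePred.polyTimeDecidable {α : Type} {enc : α → List ℕ} {Q : α → Prop}
    (hQ : PolyTimePred ⟨enc, fun _ => []⟩ Q) : PolyTimeDecidable enc Q := by
  classical
  set E : RamEnv α := ⟨enc, fun _ => []⟩
  have hf : E.PolyTime fun a => if Q a then 1 else 0 := hQ.polyTime_ite (.const 1) (.const 0)
  obtain ⟨p, hp⟩ := hf.exists_polyTriple (pos := []) (r := 0) (by simp)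
  have hcompute : PolyTriple E.size (fun a M => M = ramInput (enc a)) p
      fun a M => M 0 = (enc a).length ∧ M (E.reg a 0) = if Q a then 1 else 0 := by
    refine hp (φ := id) .refl ?_ ?_
    · rintro a M rfl
      exact ⟨fun _ _ => rfl, rfl⟩
    · rintro a M M' rfl hr hlt
      exact ⟨hlt 0 (Nat.succ_pos _), hr⟩
  obtain ⟨c, ⟨T, hT⟩, hexec⟩ := hcompute.seq <|
    .store (H' := fun a M => M 0 = if Q a then 1 else 0) (.lit 0)
      (polyEval_load_regAddr (φ := id) .refl (fun _ _ hM => hM.1) hf.1 fun _ _ hM => hM.2)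
      fun a M _ => by simp
  refine ⟨.seq p (.store (.lit 0) (.load (regAddr 0))), T, fun a => ?_⟩
  obtain ⟨M, t, hM, ht, hM0⟩ := hexec a _ rfl
  refine ⟨M, t, hM, ht.trans (hT a), fun ha => ?_, fun ha => ?_⟩ <;> simpa [ha] using hM0

end RamEnv

/-! ### Committees of maximum satisfaction -/

section Committees

variable {m n : ℕ}

/-- The satisfaction with the committee `{c}`, multiplied by `m!` in order to be a natural
number. -/
def scaledScore (A : Fin n → Finset (Fin m)) (c : Fin m) : ℕ :=
  ∑ i, if c ∈ A i then m.factorial / (A i).card else 0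

theorem factorial_mul_satisfaction (A : Fin n → Finset (Fin m)) (W : Finset (Fin m)) :
    m.factorial * satisfaction A W = (∑ c ∈ W, scaledScore A c : ℕ) := by
  simp only [satisfaction, scaledScore, Finset.mul_sum]
  rw [Finset.sum_comm, Nat.cast_sum]
  refine Finset.sum_congr rfl fun i _ => ?_
  rw [Finset.sum_ite_mem, Finset.sum_const, smul_eq_mul, Nat.cast_mul]
  rcases (A i).eq_empty_or_nonempty with h | h
  · simp [h]
  have hdvd : (A i).card ∣ m.factorial :=
    Nat.dvd_factorial h.card_pos (by simpa using (A i).card_le_univ)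
  rw [Nat.cast_div hdvd (by exact_mod_cast h.card_pos.ne')]
  ring

theorem satisfaction_lt_iff {A : Fin n → Finset (Fin m)} {W W' : Finset (Fin m)} :
    satisfaction A W' < satisfaction A W ↔
      ∑ c ∈ W', scaledScore A c < ∑ c ∈ W, scaledScore A c := by
  rw [← mul_lt_mul_iff_right₀ (by exact_mod_cast m.factorial_pos : (0 : ℚ) < m.factorial),
    factorial_mul_satisfaction, factorial_mul_satisfaction, Nat.cast_lt]

theorem satisfaction_eq_iff {A : Fin n → Finset (Fin m)} {W W' : Finset (Fin m)} :
    satisfaction A W' = satisfaction A W ↔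
      ∑ c ∈ W', scaledScore A c = ∑ c ∈ W, scaledScore A c := by
  rw [← mul_right_inj' (by exact_mod_cast m.factorial_ne_zero : (m.factorial : ℚ) ≠ 0),
    factorial_mul_satisfaction, factorial_mul_satisfaction, Nat.cast_inj]

/-- The rank of a candidate `c` of weight `w`: the weight decides, and among candidates of the same
weight the priority order does. -/
def priorityKey (tie : Equiv.Perm (Fin m)) (w : ℕ) (c : Fin m) : ℕ := w * m + (m - tie c)

theorem priorityKey_lt_iff {tie : Equiv.Perm (Fin m)} {v w : ℕ} {c d : Fin m} :
    priorityKey tie v c < priorityKey tie w d ↔ v < w ∨ v = w ∧ tie d < tie c := by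
  have hc := (tie c).isLt
  have hd := (tie d).isLt
  rw [Fin.lt_def]
  unfold priorityKey
  rcases lt_trichotomy v w with h | rfl | h
  · have := Nat.mul_le_mul_right m (Nat.succ_le_of_lt h)
    rw [Nat.succ_mul] at this
    omega
  · omega
  · have := Nat.mul_le_mul_right m (Nat.succ_le_of_lt h)
    rw [Nat.succ_mul] at this
    omega

variable {tie : Equiv.Perm (Fin m)} {w : Fin m → ℕ} {W W' : Finset (Fin m)}

/-- The committee `W` is better than `W'`: its total weight is larger, or it is equal and `W` is
preferred by the tie-breaking order. -/
def Beats (tie : Equiv.Perm (Fin m)) (w : Fin m → ℕ) (W W' : Finset (Fin m)) : Prop :=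
  ∑ c ∈ W', w c < ∑ c ∈ W, w c ∨ ∑ c ∈ W', w c = ∑ c ∈ W, w c ∧ LexPreferred tie W W'

theorem beats_exchange_iff {p q : Fin m} (hp : p ∈ W) (hq : q ∉ W) :
    Beats tie w W (insert q (W.erase p)) ↔
      priorityKey tie (w q) q < priorityKey tie (w p) p := by
  have hpq : p ≠ q := fun h => hq (h ▸ hp)
  have hsum : ∑ c ∈ insert q (W.erase p), w c + w p = ∑ c ∈ W, w c + w q := by
    rw [Finset.sum_insert (fun h => hq (Finset.mem_of_mem_erase h)), add_assoc,
      Finset.sum_erase_add _ _ hp, add_comm]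
  have hlost : W \ insert q (W.erase p) = {p} := by grind
  have hgained : insert q (W.erase p) \ W = {q} := by grind
  rw [priorityKey_lt_iff, Beats, LexPreferred, hlost, hgained]
  simp only [Finset.mem_singleton, exists_eq_left, forall_eq]
  omega

theorem beats_of_forall_priorityKey_lt (hcard : W'.card = W.card) (hne : W' ≠ W)
    (h : ∀ p ∈ W, ∀ q ∉ W, priorityKey tie (w q) q < priorityKey tie (w p) p) :
    Beats tie w W W' := by
  have hcard_sdiff : (W' \ W).card = (W \ W').card := Finset.card_sdiff_comm hcard
  have hnonempty : (W \ W').Nonempty := by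
    rw [Finset.sdiff_nonempty]
    exact fun hsub => hne (Finset.eq_of_subset_of_card_le hsub hcard.le).symm
  obtain ⟨p, hp, hmin⟩ := (W \ W').exists_min_image w hnonempty
  have hle (q) (hq : q ∈ W' \ W) : w q < w p ∨ w q = w p ∧ tie p < tie q :=
    priorityKey_lt_iff.1 (h p (Finset.mem_sdiff.1 hp).1 q (Finset.mem_sdiff.1 hq).2)
  have hle' : ∀ q ∈ W' \ W, w q ≤ w p := fun q hq => by have := hle q hq; omega
  have hlower : (W \ W').card * w p ≤ ∑ c ∈ W \ W', w c := Finset.card_nsmul_le_sum _ _ _ hmin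
  have hsum := Finset.sum_inter_add_sum_sdiff W W' w
  have hsum' := Finset.sum_inter_add_sum_sdiff W' W w
  rw [Finset.inter_comm] at hsum'
  by_cases htie : ∀ q ∈ W' \ W, tie p < tie q
  · have hupper : ∑ c ∈ W' \ W, w c ≤ (W' \ W).card * w p := Finset.sum_le_card_nsmul _ _ _ hle'
    rw [hcard_sdiff] at hupper
    rcases (show ∑ c ∈ W', w c ≤ ∑ c ∈ W, w c by omega).lt_or_eq with hlt | heq
    exacts [.inl hlt, .inr ⟨heq, p, hp, htie⟩]
  · push Not at htie
    obtain ⟨q, hq, hqp⟩ := htie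
    have hupper : ∑ c ∈ W' \ W, w c < (W' \ W).card * w p :=
      (Finset.sum_lt_sum hle' ⟨q, hq, (hle q hq).resolve_right fun h => h.2.not_ge hqp⟩).trans_eq
        (Finset.sum_const _)
    rw [hcard_sdiff] at hupper
    exact .inl (by omega)

theorem SAV_iff {A : Fin n → Finset (Fin m)} {k : ℕ} :
    SAV m n A k tie W ↔ W.card = k ∧ ∀ p ∈ W, ∀ q ∉ W,
      priorityKey tie (scaledScore A q) q < priorityKey tie (scaledScore A p) p := by
  simp only [SAV, satisfaction_lt_iff, satisfaction_eq_iff]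
  refine and_congr_right fun hk => ⟨fun h p hp q hq => (beats_exchange_iff hp hq).1 (h _ ?_ ?_),
    fun h W' hW' hne => beats_of_forall_priorityKey_lt (hW'.trans hk.symm) hne h⟩
  · rw [Finset.card_insert_of_notMem (fun h => hq (Finset.mem_of_mem_erase h)),
      Finset.card_erase_add_one hp, hk]
  · exact fun h => hq (h ▸ Finset.mem_insert_self q _)

end Committees

theorem lt_of_mem_iff_le {α : Type*} {P : Finset α} {g : α → ℕ} {θ : ℕ}
    (h : ∀ c, c ∈ P ↔ θ ≤ g c) : ∀ p ∈ P, ∀ q ∉ P, g q < g p :=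
  fun p hp q hq => (not_le.1 (mt (h q).2 hq)).trans_le ((h p).1 hp)

theorem exists_mem_iff_le {α : Type*} {P : Finset α} {g : α → ℕ} (hP : P.Nonempty)
    (h : ∀ p ∈ P, ∀ q ∉ P, g q < g p) : ∃ t, ∀ c, c ∈ P ↔ g t ≤ g c :=
  let ⟨t, ht, hmin⟩ := P.exists_min_image g hP
  ⟨t, fun c => ⟨hmin c, fun hc => by_contra fun hcP => (h t ht c hcP).not_ge hc⟩⟩

/-! ### Reading off coefficients of generating functions -/

section Digits

variable {ι : Type*} {s : Finset ι} {e : ι → ℕ} {R D : ℕ}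

theorem sum_pow_lt_pow (hs : s.card < R) (he : ∀ x ∈ s, e x < D) : ∑ x ∈ s, R ^ e x < R ^ D := by
  have hR : 0 < R := Nat.zero_lt_of_lt hs
  have hle : R * ∑ x ∈ s, R ^ e x ≤ s.card * R ^ D := by
    rw [Finset.mul_sum]
    refine Finset.sum_le_card_nsmul _ _ _ fun x hx => ?_
    rw [← pow_succ']
    exact Nat.pow_le_pow_right hR (he x hx)
  exact Nat.lt_of_mul_lt_mul_left
    (hle.trans_lt (Nat.mul_lt_mul_of_pos_right hs (pow_pos hR D)))

theorem sum_pow_div_pow_mod (hs : s.card < R) (v : ℕ) :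
    (∑ x ∈ s, R ^ e x) / R ^ v % R = (s.filter fun x => e x = v).card := by
  have hR : 0 < R := Nat.zero_lt_of_lt hs
  have hlow : ∑ x ∈ s with e x < v, R ^ e x < R ^ v :=
    sum_pow_lt_pow ((Finset.card_filter_le ..).trans_lt hs) fun x hx => (Finset.mem_filter.1 hx).2
  have hhigh : ∑ x ∈ s with ¬ e x < v, R ^ e x =
      R ^ v * ((s.filter fun x => e x = v).card +
        R * ∑ x ∈ s with v < e x, R ^ (e x - (v + 1))) := by
    simp only [Finset.card_filter, Finset.mul_sum, mul_add, Finset.sum_filter,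
      ← Finset.sum_add_distrib]
    refine Finset.sum_congr rfl fun x _ => ?_
    rcases lt_trichotomy (e x) v with h | h | h
    · simp [h, h.ne, h.not_gt]
    · simp [h]
    · simp only [h.not_gt, h.ne', h, not_false_eq_true, if_true, if_false, mul_zero, zero_add]
      rw [← pow_succ', ← pow_add]
      congr 1
      omega
  rw [← Finset.sum_filter_add_sum_filter_not s (fun x => e x < v), hhigh,
    Nat.add_mul_div_left _ _ (pow_pos hR v), Nat.div_eq_of_lt hlow, zero_add,
    Nat.add_mul_mod_self_left, Nat.mod_eq_of_lt ((Finset.card_filter_le ..).trans_lt hs)]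


variable {κ : Type*} [Fintype κ] [DecidableEq κ] {A : κ → Finset ι}

theorem prod_sum_pow_eq :
    ∏ c, ∑ x ∈ A c, R ^ e x = ∑ f ∈ Fintype.piFinset A, R ^ ∑ c, e (f c) := by
  rw [Finset.prod_univ_sum]
  exact Finset.sum_congr rfl fun f _ => Finset.prod_pow_eq_pow_sum ..

theorem prod_sum_pow_lt_pow (hA : (Fintype.piFinset A).card < R)
    (he : ∀ f ∈ Fintype.piFinset A, ∑ c, e (f c) < D) : ∏ c, ∑ x ∈ A c, R ^ e x < R ^ D :=
  prod_sum_pow_eq.trans_lt (sum_pow_lt_pow hA he)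

theorem prod_sum_pow_div_pow_mod_pos_iff (hA : (Fintype.piFinset A).card < R) {v : ℕ} :
    0 < (∏ c, ∑ x ∈ A c, R ^ e x) / R ^ v % R ↔
      ∃ f : κ → ι, (∀ c, f c ∈ A c) ∧ ∑ c, e (f c) = v := by
  simp [prod_sum_pow_eq, sum_pow_div_pow_mod hA, Finset.card_pos, Finset.filter_nonempty_iff]

end Digits

/-! ### The sizes of the additional ballots and the votes for each candidate -/

section Votes

variable {m n j : ℕ}

theorem scaledScore_append (A : Fin n → Finset (Fin m)) (B : Fin j → Finset (Fin m)) (c : Fin m) :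
    scaledScore (Fin.append A B) c =
      scaledScore A c + ∑ i with c ∈ B i, m.factorial / (B i).card := by
  simp [scaledScore, Fin.sum_univ_add, Finset.sum_filter]

/-- The sizes of `j` ballots on `m` candidates, encoded as the digits in base `m + 1` of a single
number. -/
def sizeCode (B : Fin j → Finset (Fin m)) : Fin ((m + 1) ^ j) :=
  finFunctionFinEquiv fun i => ⟨(B i).card, Nat.lt_succ_iff.2 (card_finset_fin_le (B i))⟩

/-- The size of the `i`-th ballot, given the code `v` of all sizes. -/
def decodeSize (m v i : ℕ) : ℕ := v / (m + 1) ^ i % (m + 1)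

theorem decodeSize_sizeCode (B : Fin j → Finset (Fin m)) (i : Fin j) :
    decodeSize m (sizeCode B) i = (B i).card := by
  have h := finFunctionFinEquiv.symm_apply_apply
    fun i => (⟨(B i).card, Nat.lt_succ_iff.2 (card_finset_fin_le (B i))⟩ : Fin (m + 1))
  exact congrArg Fin.val (congrFun h i)

/-- The contribution to the code of the ballot sizes of a candidate contained in the ballots with
indices in `S`. -/
def voteCode (m : ℕ) (S : Finset (Fin j)) : ℕ := ∑ i ∈ S, (m + 1) ^ (i : ℕ)

theorem sum_voteCode (B : Fin j → Finset (Fin m)) :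
    ∑ c, voteCode m {i | c ∈ B i} = sizeCode B := by
  simp only [voteCode, Finset.sum_filter]
  rw [Finset.sum_comm, sizeCode, finFunctionFinEquiv_apply]
  simp

end Votes

namespace WSMInstance

variable {j : ℕ} (I : WSMInstance)

/-- The rank of the candidate `c` after `j` more ballots have been cast, of sizes encoded by `v`, if
`c` is contained in those with indices in `S`. -/
def key (v : ℕ) (S : Finset (Fin j)) (c : Fin I.m) : ℕ :=
  priorityKey I.tie
    (scaledScore I.ballots c + ∑ i ∈ S, I.m.factorial / decodeSize I.m v i) c

/-- The base of the number `genNumber`: it exceeds the number `(2 ^ j) ^ m` of ways to cast the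
additional ballots, so that digits do not overflow. -/
def genBase (j : ℕ) : ℕ := 2 ^ (j * I.m + 1)

/-- The value at `genBase` of a generating function: the coefficient of degree `u` counts the ways
to cast the additional ballots with sizes encoded by `u` in such a way that, if the satisfactions
are computed with the sizes encoded by `v`, exactly the candidates in `P` have rank at least `θ`. -/
def genNumber (j v θ : ℕ) : ℕ :=
  ∏ c, ∑ S : Finset (Fin j) with (c ∈ I.P ↔ θ ≤ I.key v S c), I.genBase j ^ voteCode I.m S

theorem card_piFinset_lt_genBase (A : Fin I.m → Finset (Finset (Fin j))) :
    (Fintype.piFinset A).card < I.genBase j := by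
  refine (Finset.card_le_univ _).trans_lt ?_
  simp only [Fintype.card_fun, Fintype.card_finset, Fintype.card_fin, genBase, ← pow_mul]
  exact Nat.pow_lt_pow_right one_lt_two (Nat.lt_succ_self _)

theorem sum_voteCode_lt (f : Fin I.m → Finset (Fin j)) :
    ∑ c, voteCode I.m (f c) < (I.m + 1) ^ j := by
  have h := sum_voteCode fun i => Finset.univ.filter fun c => i ∈ f c
  simp only [Finset.mem_filter_univ, Finset.filter_mem_eq_inter, Finset.univ_inter] at h
  exact h ▸ Fin.isLt _

theorem genNumber_lt (v θ : ℕ) : I.genNumber j v θ < I.genBase j ^ (I.m + 1) ^ j :=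
  prod_sum_pow_lt_pow (I.card_piFinset_lt_genBase _) fun f _ => I.sum_voteCode_lt f

theorem exists_ballots_iff {v : Fin ((I.m + 1) ^ j)} {θ : ℕ} :
    (∃ B : Fin j → Finset (Fin I.m),
        sizeCode B = v ∧ ∀ c, c ∈ I.P ↔ θ ≤ I.key v {i | c ∈ B i} c) ↔
      0 < I.genNumber j v θ / I.genBase j ^ (v : ℕ) % I.genBase j := by
  rw [genNumber, prod_sum_pow_div_pow_mod_pos_iff (I.card_piFinset_lt_genBase _)]
  constructor
  · rintro ⟨B, rfl, hB⟩
    exact ⟨fun c => Finset.univ.filter fun i => c ∈ B i, by simpa using hB, sum_voteCode B⟩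
  · rintro ⟨f, hf, hv⟩
    obtain ⟨B, rfl⟩ : ∃ B : Fin j → Finset (Fin I.m),
        f = fun c => Finset.univ.filter fun i => c ∈ B i :=
      ⟨fun i => {c | i ∈ f c}, by ext; simp⟩
    exact ⟨B, Fin.ext ((sum_voteCode B).symm.trans hv), by simpa using hf⟩

theorem winningSetManipulation_SAV_iff :
    WinningSetManipulation SAV j I ↔ I.P.card = I.k ∧ (I.P.card = 0 ∨
      ∃ (v : Fin ((I.m + 1) ^ j)) (t : Fin I.m) (S : Finset (Fin j)),
        0 < I.genNumber j v (I.key v S t) / I.genBase j ^ (v : ℕ) % I.genBase j) := by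
  have hkey (B : Fin j → Finset (Fin I.m)) (c : Fin I.m) :
      priorityKey I.tie (scaledScore (Fin.append I.ballots B) c) c =
        I.key (sizeCode B) {i | c ∈ B i} c := by
    simp only [key, scaledScore_append, decodeSize_sizeCode]
  simp only [WinningSetManipulation, SAV_iff, exists_and_left, hkey, ← exists_ballots_iff]
  refine and_congr_right fun _ => ⟨?_, ?_⟩
  · rintro ⟨B, hB⟩
    refine I.P.eq_empty_or_nonempty.imp Finset.card_eq_zero.2 fun hP => ?_
    obtain ⟨t, ht⟩ := exists_mem_iff_le (g := fun c => I.key (sizeCode B) _ c) hP hB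
    exact ⟨_, t, _, B, rfl, ht⟩
  · rintro (hP | ⟨_, t, S, B, rfl, hB⟩)
    · exact ⟨fun _ => ∅, by simp [Finset.card_eq_zero.1 hP]⟩
    · exact ⟨B, lt_of_mem_iff_le hB⟩

end WSMInstance

/-! ### The encoding of instances -/

theorem length_indicatorList {m : ℕ} (S : Finset (Fin m)) : (indicatorList S).length = m := by
  simp [indicatorList]

theorem getD_ofFn {m : ℕ} {β : Type*} (f : Fin m → β) (c : Fin m) (d : β) :
    (List.ofFn f).getD c d = f c := by simp

theorem getD_indicatorList {m : ℕ} (S : Finset (Fin m)) (c : Fin m) :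
    (indicatorList S).getD c 0 = if c ∈ S then 1 else 0 := getD_ofFn ..

theorem getD_flatten_of_length_eq {L : List (List ℕ)} {m : ℕ} (hL : ∀ a ∈ L, a.length = m)
    (i : ℕ) {c : ℕ} (hc : c < m) : L.flatten.getD (i * m + c) 0 = (L.getD i []).getD c 0 := by
  induction L generalizing i with
  | nil => simp
  | cons a L ih =>
    obtain ⟨ha, hL⟩ := List.forall_mem_cons.1 hL
    cases i with
    | zero =>
      rw [List.flatten_cons, List.getD_append _ _ _ _ (by omega), zero_mul, zero_add,
        List.getD_cons_zero]
    | succ i =>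
      have hi : (i + 1) * m + c = a.length + (i * m + c) := by rw [ha, Nat.succ_mul]; omega
      rw [List.flatten_cons, hi, List.getD_append_right _ _ _ _ (Nat.le_add_right ..),
        Nat.add_sub_cancel_left, List.getD_cons_succ, ih hL]

namespace WSMInstance

variable (I : WSMInstance)

theorem length_encode : I.encode.length = 3 + 2 * I.m + I.n * I.m := by
  have hballots : (List.length ∘ fun i => indicatorList (I.ballots i)) = fun _ => I.m :=
    funext fun i => length_indicatorList _
  simp only [encode, List.length_append, List.length_flatten, List.map_ofFn, List.length_ofFn,
    List.sum_ofFn, hballots, length_indicatorList, List.length_cons, List.length_nil,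
    Finset.sum_const, Finset.card_univ, Fintype.card_fin, smul_eq_mul]
  ring

theorem ramInput_P (c : Fin I.m) :
    ramInput I.encode (4 + c) = if c ∈ I.P then 1 else 0 := by
  have haddr : 4 + (c : ℕ) = [I.m, I.n, I.k].length + c + 1 := by
    simp only [List.length_cons, List.length_nil]
    omega
  rw [haddr, ramInput, List.getD_cons_succ, encode, List.append_assoc, List.append_assoc,
    List.getD_append_right _ _ _ _ (Nat.le_add_right ..), Nat.add_sub_cancel_left,
    List.getD_append _ _ _ _ (by rw [length_indicatorList]; exact c.isLt), getD_indicatorList]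

theorem ramInput_tie (c : Fin I.m) : ramInput I.encode (4 + I.m + c) = I.tie c := by
  have haddr : 4 + I.m + (c : ℕ) = ([I.m, I.n, I.k] ++ indicatorList I.P).length + c + 1 := by
    simp only [List.length_append, List.length_cons, List.length_nil, length_indicatorList]
    omega
  rw [haddr, ramInput, List.getD_cons_succ, encode, List.append_assoc,
    List.getD_append_right _ _ _ _ (Nat.le_add_right ..), Nat.add_sub_cancel_left,
    List.getD_append _ _ _ _ (by rw [List.length_ofFn]; exact c.isLt), getD_ofFn]

theorem ramInput_ballots (i : Fin I.n) (c : Fin I.m) :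
    ramInput I.encode (4 + 2 * I.m + i * I.m + c) = if c ∈ I.ballots i then 1 else 0 := by
  have haddr : 4 + 2 * I.m + i * I.m + (c : ℕ) = ([I.m, I.n, I.k] ++ indicatorList I.P ++
      List.ofFn fun c : Fin I.m => (I.tie c : ℕ)).length + (i * I.m + c) + 1 := by
    simp only [List.length_append, List.length_cons, List.length_nil, length_indicatorList,
      List.length_ofFn]
    omega
  have hlength : ∀ a ∈ List.ofFn fun i => indicatorList (I.ballots i), a.length = I.m :=
    List.forall_mem_ofFn_iff.2 fun i => length_indicatorList _
  rw [haddr, ramInput, List.getD_cons_succ, encode,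
    List.getD_append_right _ _ _ _ (Nat.le_add_right ..), Nat.add_sub_cancel_left,
    getD_flatten_of_length_eq hlength _ c.isLt, getD_ofFn, getD_indicatorList]

end WSMInstance

/-! ### Computations with instances -/

namespace WSMInstance

open RamEnv

variable {α : Type*} {E : RamEnv α} {I : α → WSMInstance} {j : ℕ} {v θ : α → ℕ}
  {c : ∀ a, Fin (I a).m} {i : ∀ a, Fin (I a).n} (hE : ∀ a, E.input a = (I a).encode)

include hE

theorem polyTimeUnary_m : E.PolyTimeUnary fun a => (I a).m where
  polyTime := ((PolyTime.const 1).read fun a => by rw [hE, length_encode]; omega).congr fun a => by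
    rw [hE]; rfl
  polyBounded := .of_le fun a => (show (I a).m ≤ (E.input a).length by
    rw [hE, length_encode]; omega).trans (length_input_le_size a)

theorem polyTimeUnary_n (hm : ∀ a, 0 < (I a).m) :
    E.PolyTimeUnary fun a => (I a).n where
  polyTime := ((PolyTime.const 2).read fun a => by rw [hE, length_encode]; omega).congr fun a => by
    rw [hE]; rfl
  polyBounded := .of_le fun a => by
    have hn : (I a).n ≤ (I a).n * (I a).m := Nat.le_mul_of_pos_right _ (hm a)
    have hlen := length_input_le_size (E := E) a
    rw [hE, length_encode] at hlen
    omega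

theorem polyTime_k : E.PolyTime fun a => (I a).k :=
  ((PolyTime.const 3).read fun a => by rw [hE, length_encode]; omega).congr fun a => by
    rw [hE]; rfl

theorem polyTimePred_mem_P (hc : E.PolyTime fun a => c a) : 
    E.PolyTimePred fun a => c a ∈ (I a).P :=
  ⟨_, ((PolyTime.const 4).add hc).read fun a => by rw [hE, length_encode]; omega, fun a => by
    rw [hE, ramInput_P]; simp⟩

theorem polyTime_tie (hc : E.PolyTime fun a => c a) : E.PolyTime fun a => (I a).tie (c a) :=
  ((((PolyTime.const 4).add (polyTimeUnary_m hE).1).add hc).read fun a => by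
    rw [hE, length_encode]; omega).congr fun a => by rw [hE, ramInput_tie]

theorem polyTimePred_mem_ballots (hi : E.PolyTime fun a => i a) (hc : E.PolyTime fun a => c a) :
    E.PolyTimePred fun a => c a ∈ (I a).ballots (i a) := by
  have hm := (polyTimeUnary_m hE).1
  refine ⟨_, ((((PolyTime.const 4).add ((PolyTime.const 2).mul hm)).add (hi.mul hm)).add hc).read
    fun a => ?_, fun a => by rw [hE, ramInput_ballots]; simp⟩
  have := Nat.mul_le_mul_right (I a).m (i a).isLt
  rw [Nat.succ_mul] at this
  rw [hE, length_encode]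
  omega

theorem polyTime_factorial_div {f : α → ℕ} (hf : E.PolyTime f) :
    E.PolyTime fun a => (I a).m.factorial / f a := by
  have hm := polyTimeUnary_m hE
  refine (PolyTime.factorial hm).div hf ((hm.mul hm).add (.const 1)) fun a => ?_
  calc (I a).m.factorial ≤ (I a).m ^ (I a).m := Nat.factorial_le_pow _
    _ ≤ (2 ^ (I a).m) ^ (I a).m := Nat.pow_le_pow_left Nat.lt_two_pow_self.le _
    _ < 2 ^ ((I a).m * (I a).m + 1) := by
      rw [← pow_mul]
      exact Nat.pow_lt_pow_right one_lt_two (Nat.lt_succ_self _)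

theorem polyTime_card_ballots (hi : E.PolyTime fun a => i a) :
    E.PolyTime fun a => ((I a).ballots (i a)).card :=
  have hm := polyTimeUnary_m hE
  PolyTimePred.polyTime_card hm
    (polyTimePred_mem_ballots (fun e => hE e.1) hi.extend (PolyTimeUnary.index hm.2).1)

theorem polyTime_scaledScore (hc : E.PolyTime fun a => c a) :
    E.PolyTime fun a => scaledScore (I a).ballots (c a) := by
  have hn := polyTimeUnary_n hE fun a => Fin.pos (c a)
  have hi := (PolyTimeUnary.index hn.2).1
  have hE' (e : Σ a, Fin (I a).n) : (E.bind fun a => (I a).n).input e = (I e.1).encode := hE e.1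
  have hterm : (E.bind fun a => (I a).n).PolyTime fun e => if c e.1 ∈ (I e.1).ballots e.2 then
      (I e.1).m.factorial / ((I e.1).ballots e.2).card else 0 :=
    (polyTimePred_mem_ballots hE' hi hc.extend).polyTime_ite
      (polyTime_factorial_div hE' (polyTime_card_ballots hE' hi)) (.const 0)
  exact .sum hn hterm

theorem polyTime_decodeSize (hv : E.PolyTimeUnary v) (i : ℕ) :
    E.PolyTime fun a => decodeSize (I a).m (v a) i := by
  have hm := (polyTimeUnary_m hE).add (.const 1)
  exact (hv.1.div (hm.1.pow (.const i)) hv fun a => Nat.lt_two_pow_self).mod hm.1 hv fun a =>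
    (Nat.div_le_self ..).trans_lt Nat.lt_two_pow_self

theorem polyTime_key (hv : E.PolyTimeUnary v)
    (S : Finset (Fin j)) (hc : E.PolyTime fun a => c a) :
    E.PolyTime fun a => (I a).key (v a) S (c a) := by
  have hm := (polyTimeUnary_m hE).1
  have hvotes : E.PolyTime fun a => ∑ i ∈ S, (I a).m.factorial / decodeSize (I a).m (v a) i :=
    .finset_sum S fun i _ => polyTime_factorial_div hE (polyTime_decodeSize hE hv i)
  exact (((polyTime_scaledScore hE hc).add hvotes).mul hm).add (hm.sub (polyTime_tie hE hc))

theorem polyTimeUnary_voteCode (S : Finset (Fin j)) :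
    E.PolyTimeUnary fun a => voteCode (I a).m S := by
  simp only [voteCode]
  exact .finset_sum S fun i _ => ((polyTimeUnary_m hE).add (.const 1)).pow_const i

theorem polyTime_genBase : E.PolyTime fun a => (I a).genBase j :=
  (PolyTime.const 2).pow (((PolyTimeUnary.const j).mul (polyTimeUnary_m hE)).add (.const 1))

theorem polyTime_genNumber (hv : E.PolyTimeUnary v)
    (hθ : E.PolyTime θ) : E.PolyTime fun a => (I a).genNumber j (v a) (θ a) := by
  have hm := polyTimeUnary_m hE
  have hc := (PolyTimeUnary.index hm.2).1
  have hE' (e : Σ a, Fin (I a).m) : (E.bind fun a => (I a).m).input e = (I e.1).encode := hE e.1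
  have hfactor : (E.bind fun a => (I a).m).PolyTime fun e => ∑ S : Finset (Fin j),
      if e.2 ∈ (I e.1).P ↔ θ e.1 ≤ (I e.1).key (v e.1) S e.2 then
        (I e.1).genBase j ^ voteCode (I e.1).m S else 0 :=
    .finset_sum _ fun S _ => ((polyTimePred_mem_P hE' hc).iff
      (.le hθ.extend (polyTime_key hE' hv.extend S hc))).polyTime_ite
        ((polyTime_genBase hE').pow (polyTimeUnary_voteCode hE' S)) (.const 0)
  simpa only [genNumber, Finset.sum_filter] using PolyTime.prod hm hfactor

theorem polyTimePred_exists_ballots (hv : E.PolyTimeUnary v)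
    (hθ : E.PolyTime θ) : E.PolyTimePred fun a => 0 <
      (I a).genNumber j (v a) (θ a) / (I a).genBase j ^ v a % (I a).genBase j := by
  have hm := polyTimeUnary_m hE
  have hR := polyTime_genBase (j := j) hE
  have hK := (((PolyTimeUnary.const j).mul hm).add (.const 1)).mul
    ((hm.add (.const 1)).pow_const j)
  have hlt (a : α) : (I a).genNumber j (v a) (θ a) <
      2 ^ ((j * (I a).m + 1) * ((I a).m + 1) ^ j) := by
    rw [pow_mul]
    exact (I a).genNumber_lt (v a) (θ a)
  exact .lt (.const 0) <| ((polyTime_genNumber hE hv hθ).div (hR.pow hv) hK hlt).mod hR hK fun a =>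
    (Nat.div_le_self ..).trans_lt (hlt a)

theorem polyTimePred_winningSetManipulation_SAV (j : ℕ) :
    E.PolyTimePred fun a => WinningSetManipulation SAV j (I a) := by
  have hm := polyTimeUnary_m hE
  have hcard : E.PolyTime fun a => (I a).P.card :=
    PolyTimePred.polyTime_card hm
      (polyTimePred_mem_P (fun e => hE e.1) (PolyTimeUnary.index hm.2).1)
  have hN := (hm.add (.const 1)).pow_const j
  have hm' := hm.extend (π := Sigma.fst) (v := fun e : Σ a, Fin (((I a).m + 1) ^ j) => e.2)
  have hv := (PolyTimeUnary.index hN.2).extend (π := Sigma.fst)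
    (v := fun e : Σ e : Σ a, Fin (((I a).m + 1) ^ j), Fin (I e.1).m => e.2)
  refine PolyTimePred.congr ?_ fun a => (winningSetManipulation_SAV_iff (I a)).symm
  exact (PolyTimePred.eq hcard (polyTime_k hE)).and <| (PolyTimePred.eq hcard (.const 0)).or <|
    .exists_fin hN <| .exists_fin hm' <| .exists_of_finite fun S =>
      polyTimePred_exists_ballots (fun e => hE e.1.1) hv
        (polyTime_key (fun e => hE e.1.1) hv S (PolyTimeUnary.index hm'.2).1)

end WSMInstance

theorem mainTheorem8_general (j : ℕ) :
    PolyTimeDecidable WSMInstance.encode (WinningSetManipulation SAV j) :=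
  (WSMInstance.polyTimePred_winningSetManipulation_SAV (fun _ => rfl) j).polyTimeDecidable

theorem mainTheorem8 :
    PolyTimeDecidable WSMInstance.encode (WinningSetManipulation SAV 2) :=
  mainTheorem8_general 2
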